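/- Let $\mathcal C$ be the class of finite-dimensional real Lie groups $G$ with Lie algebra $\mathfrak g$ such that the identity component of $G$ is non-commutative (for connected $G$: $G$ is non-commutative) and, for all $x,y\in\mathfrak g$, the bracket $[x,y]$ is a linear combination of $x$ and $y$. Let $G\in\mathcal C$. Then: (1) $G$ is not unimodular, i.e. its left Haar measures are not right-invariant. (2) Let $\mu$ be any left-invariant (smooth) pseudo-Riemannian metric on $G$, of arbitrary signature, such that the restriction of the scalar product $\langle\cdot,\cdot\rangle=\mu(e)$ to the derived ideal $[\mathfrak g,\mathfrak g]$ is degenerate. Then $\mu$ is flat, i.e. the curvature $K(u,v)=\mathrm L_{[u,v]}-[\mathrm L_u,\mathrm L_v]$ vanishes for all $u,v\in\mathfrak g$, where $\mathrm L_u(v)=uv$ is the Levi-Civita product on $\mathfrak g$, given by $2\langle uv,w\rangle=\langle[u,v],w\rangle-\langle[v,w],u\rangle+\langle[w,u],v\rangle$. Moreover, $\mu$ is geodesically incomplete: there are a point of $G$ and a tangent vector at this point that is not the initial velocity of any geodesic of $\mu$ defined on all of $\mathbb R$. -/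

import Mathlib

open scoped Manifold ContDiff
open Bundle MeasureTheory

noncomputable section

namespace PseudoRiemannianLie

section Metric

/-- A smooth pseudo-Riemannian metric on a manifold `M` modelled on `E`: a smooth field of
nondegenerate symmetric bilinear forms on the tangent spaces (of arbitrary signature). -/
structure PseudoRiemannianMetric (E : Type*) [NormedAddCommGroup E] [NormedSpace ℝ E]
    (M : Type*) [TopologicalSpace M] [ChartedSpace E M] [IsManifold 𝓘(ℝ, E) 1 M] where
  /-- The bilinear form on each tangent space. -/
  inner (p : M) : TangentSpace 𝓘(ℝ, E) p →L[ℝ] TangentSpace 𝓘(ℝ, E) p →L[ℝ] ℝ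
  symm (p : M) (v w : TangentSpace 𝓘(ℝ, E) p) : inner p v w = inner p w v
  nondegenerate (p : M) (v : TangentSpace 𝓘(ℝ, E) p) : (∀ w, inner p v w = 0) → v = 0
  contMDiff : ContMDiff 𝓘(ℝ, E) (𝓘(ℝ, E).prod 𝓘(ℝ, E →L[ℝ] E →L[ℝ] ℝ)) ∞
    (fun p ↦ TotalSpace.mk' (E →L[ℝ] E →L[ℝ] ℝ)
      (E := fun q : M ↦ TangentSpace 𝓘(ℝ, E) q →L[ℝ] TangentSpace 𝓘(ℝ, E) q →L[ℝ] ℝ)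
      p (inner p))

variable {E : Type*} [NormedAddCommGroup E] [NormedSpace ℝ E]
  {M : Type*} [TopologicalSpace M] [ChartedSpace E M] [IsManifold 𝓘(ℝ, E) 1 M]

/-- The coefficients of the metric in the preferred chart `φ` at `p`: for constant vectors
`v w : E`, the function `x ↦ g (φ⁻¹ x) (dφ⁻¹ v, dφ⁻¹ w)` on the target of `φ`. -/
def PseudoRiemannianMetric.coeff (g : PseudoRiemannianMetric E M) (p : M) (v w : E) (x : E) : ℝ :=
  g.inner ((extChartAt 𝓘(ℝ, E) p).symm x)
    (mfderiv 𝓘(ℝ, E) 𝓘(ℝ, E) (extChartAt 𝓘(ℝ, E) p).symm x v)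
    (mfderiv 𝓘(ℝ, E) 𝓘(ℝ, E) (extChartAt 𝓘(ℝ, E) p).symm x w)

/-- The Christoffel symbols of the first kind of the Levi-Civita connection in the preferred chart
at `p`, that is `½ (∂ᵤ g(v, w) + ∂ᵥ g(u, w) - ∂_w g(u, v))` at `x` for constant vectors `u v w`. -/
def PseudoRiemannianMetric.christoffel (g : PseudoRiemannianMetric E M) (p : M)
    (u v w : E) (x : E) : ℝ :=
  (fderiv ℝ (g.coeff p v w) x u + fderiv ℝ (g.coeff p u w) x v
    - fderiv ℝ (g.coeff p u v) x w) / 2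

/-- A curve `γ : ℝ → M` is a geodesic of `g` (defined on the whole real line) if it is smooth and
`∇_{γ'} γ' = 0` for the Levi-Civita connection `∇` of `g`. At time `t` this is written in the
preferred chart at `γ t`, with `c` the coordinate expression of `γ`, and paired with an arbitrary
vector `w`; as `g` is nondegenerate, this is the usual equation `c'' + Γ(c', c') = 0`. -/
def PseudoRiemannianMetric.IsGeodesic (g : PseudoRiemannianMetric E M) (γ : ℝ → M) : Prop :=
  ContMDiff 𝓘(ℝ, ℝ) 𝓘(ℝ, E) ∞ γ ∧
    ∀ (t : ℝ) (w : E),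
      let c : ℝ → E := fun s ↦ extChartAt 𝓘(ℝ, E) (γ t) (γ s)
      g.coeff (γ t) (deriv (deriv c) t) w (c t)
        + g.christoffel (γ t) (deriv c t) (deriv c t) w (c t) = 0

/-- `g` is geodesically complete if for every point and every tangent vector at that point there
is a geodesic with this initial velocity that is defined for all real times. -/
def PseudoRiemannianMetric.IsGeodesicallyComplete (g : PseudoRiemannianMetric E M) : Prop :=
  ∀ v : TangentBundle 𝓘(ℝ, E) M, ∃ γ : ℝ → M, g.IsGeodesic γ ∧
    (⟨γ 0, mfderiv 𝓘(ℝ, ℝ) 𝓘(ℝ, E) γ 0 (1 : ℝ)⟩ : TangentBundle 𝓘(ℝ, E) M) = v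

end Metric

section Group

/-- A (locally compact) topological group is unimodular if its left Haar measures are also
right-invariant. -/
def IsUnimodular (G : Type*) [Group G] [TopologicalSpace G] [MeasurableSpace G] : Prop :=
  ∀ μ : Measure G, μ.IsHaarMeasure → μ.Regular → μ.IsMulRightInvariant

variable (E : Type*) [NormedAddCommGroup E] [NormedSpace ℝ E]
  (G : Type*) [TopologicalSpace G] [ChartedSpace E G] [Group G]

/-- The class `𝒞`: Lie groups which are noncommutative and for which `[x, y]` is a linear
combination of `x` and `y`, for all `x` and `y` in the Lie algebra. Noncommutativity is required
of the identity component; for a connected group this is noncommutativity of the group. -/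
structure IsInClassC : Prop where
  noncommutative : ∃ a ∈ connectedComponent (1 : G), ∃ b ∈ connectedComponent (1 : G),
    a * b ≠ b * a
  bracket_mem_span : ∀ x y : GroupLieAlgebra 𝓘(ℝ, E) G, ⁅x, y⁆ ∈ Submodule.span ℝ {x, y}

/-- The derived ideal `[𝔤, 𝔤]` of the Lie algebra `𝔤` of `G`, as a linear subspace. -/
def derivedIdeal : Submodule ℝ (GroupLieAlgebra 𝓘(ℝ, E) G) :=
  Submodule.span ℝ {z | ∃ x y : GroupLieAlgebra 𝓘(ℝ, E) G, ⁅x, y⁆ = z}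

variable {E G}
variable [IsManifold 𝓘(ℝ, E) 1 G]

/-- `μ` is left-invariant: all left translations `x ↦ a * x` are isometries. -/
def PseudoRiemannianMetric.IsLeftInvariant (μ : PseudoRiemannianMetric E G) : Prop :=
  ∀ (a x : G) (v w : TangentSpace 𝓘(ℝ, E) x),
    μ.inner (a * x) (mfderiv 𝓘(ℝ, E) 𝓘(ℝ, E) (a * ·) x v)
      (mfderiv 𝓘(ℝ, E) 𝓘(ℝ, E) (a * ·) x w) = μ.inner x v w

/-- The restriction of the scalar product `μ(e)` to `[𝔤, 𝔤]` is degenerate: its radical contains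
a nonzero vector. -/
def PseudoRiemannianMetric.IsDegenerateOnDerivedIdeal (μ : PseudoRiemannianMetric E G) : Prop :=
  ∃ x ∈ derivedIdeal E G, x ≠ 0 ∧ ∀ y ∈ derivedIdeal E G, μ.inner 1 x y = 0

/-- `P u v = ∇ᵤ v` is the Levi-Civita product on `𝔤` of the left-invariant metric `μ`, that is
`2⟨uv, w⟩ = ⟨[u, v], w⟩ - ⟨[v, w], u⟩ + ⟨[w, u], v⟩`. Nondegeneracy makes it unique. -/
def PseudoRiemannianMetric.IsLeviCivitaProduct (μ : PseudoRiemannianMetric E G)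
    (P : GroupLieAlgebra 𝓘(ℝ, E) G → GroupLieAlgebra 𝓘(ℝ, E) G → GroupLieAlgebra 𝓘(ℝ, E) G) :
    Prop :=
  ∀ u v w : GroupLieAlgebra 𝓘(ℝ, E) G,
    2 * μ.inner 1 (P u v) w
      = μ.inner 1 ⁅u, v⁆ w - μ.inner 1 ⁅v, w⁆ u + μ.inner 1 ⁅w, u⁆ v

/-- A left-invariant metric is flat if the curvature `K(u, v) = L_{[u, v]} - [L_u, L_v]` of its
Levi-Civita product vanishes identically, where `L_u v = uv`. -/
def PseudoRiemannianMetric.IsFlatLeftInvariant (μ : PseudoRiemannianMetric E G) : Prop :=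
  ∃ P : GroupLieAlgebra 𝓘(ℝ, E) G → GroupLieAlgebra 𝓘(ℝ, E) G → GroupLieAlgebra 𝓘(ℝ, E) G,
    μ.IsLeviCivitaProduct P ∧ ∀ u v w, P ⁅u, v⁆ w - (P u (P v w) - P v (P u w)) = 0

end Group

end PseudoRiemannianLie

end

/-!
The Lie algebra of a group in the class `𝒞` has the bracket `[v, w] = l v • w - l w • v` for a
linear form `l`: for every `v`, the map `ad v` fixes all lines modulo `v`, so that it is a homothety
modulo `v`, and its ratio is linear in `v` because it is proportional to the trace of `ad v`
(`exists_dual_of_forall_mem_span`). The form `l` is nonzero, since a Lie group with a commutative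
Lie algebra has a commutative identity component: the derivative of `Ad` is `ad = 0` at the
identity, hence vanishes everywhere, so `Ad` is trivial on the identity component; then the
commutator map with a fixed element has vanishing derivative, too
(`commute_of_forall_modelBracket_eq_zero`).

If a Haar measure were bi-invariant, the integral of the derivative of a test function along any
left-invariant or right-invariant vector field would vanish. Expanding a right-invariant field in a
left-invariant frame, one finds that its divergence vanishes. At the identity this divergence is
the trace of `ad v` (`trace_modelAd_eq_zero`), which equals `(n - 1) l v`, where `n ≥ 2`.

The derived ideal is the kernel of `l`. If the metric is degenerate on it, then `l` is the scalar
product with a vector `d` such that `l d = 0`. The Levi-Civita product is then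
`u v = ⟨u, v⟩ d - l v • u`, and its curvature is zero by a direct computation. Along a geodesic `γ`,
the scalar product `f` of `γ'` with the left-invariant field `D` extending `d` satisfies
`f' = ⟨∇_{γ'} D, γ'⟩ = f ^ 2` (`PseudoRiemannianMetric.IsLeftInvariant.hasDerivAt_momentum`), so
a geodesic with `f 0 = 1` cannot be defined for all times.

All computations take place in the preferred charts. The left-invariant vector fields are given
there by a smooth operator-valued function `leftFrame p`, the partial derivative of the
multiplication, and both the bracket and the coefficients of a left-invariant metric are expressed
through it.
-/

noncomputable section

namespace PseudoRiemannianLie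

/-! ### The multiplication and the invariant frames in charts -/

section Chart

open Filter Set
open scoped Topology

variable {E : Type*} [NormedAddCommGroup E] [NormedSpace ℝ E]
  {G : Type*} [TopologicalSpace G] [ChartedSpace E G]

/-- The preferred chart at `p`, as a partial equivalence from the manifold to its model space. -/
local notation "φ" => extChartAt 𝓘(ℝ, E)

theorem symm_contMDiffAt [IsManifold 𝓘(ℝ, E) ∞ G] {p : G} {x : E} (hx : x ∈ (φ p).target) :
    ContMDiffAt 𝓘(ℝ, E) 𝓘(ℝ, E) ∞ (φ p).symm x :=
  (contMDiffOn_extChartAt_symm p).contMDiffAt ((isOpen_extChartAt_target p).mem_nhds hx)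

theorem chart_contMDiffAt [IsManifold 𝓘(ℝ, E) ∞ G] {p q : G} (hq : q ∈ (φ p).source) :
    ContMDiffAt 𝓘(ℝ, E) 𝓘(ℝ, E) ∞ (φ p) q :=
  contMDiffAt_extChartAt' (by rwa [← extChartAt_source 𝓘(ℝ, E)])

variable [Group G]

/-- The multiplication of a Lie group read in charts: in the chart at `1` for the right factor, and
in the chart at `p` for the left factor and for the product. -/
def chartMul (p : G) (z : E × E) : E := φ p ((φ p).symm z.1 * (φ (1 : G)).symm z.2)

/-- The frame of left-invariant vector fields in the chart at `p`: the vector `leftFrame p x v` is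
the value at `x` of the coordinate expression of the left-invariant field extending `v`. -/
def leftFrame (p : G) (x : E) : E →L[ℝ] E :=
  fderiv ℝ (chartMul p) (x, φ (1 : G) 1) ∘L ContinuousLinearMap.inr ℝ E E

variable (G) in
/-- The frame of right-invariant vector fields, in the chart at `1`. -/
def rightFrame (x : E) : E →L[ℝ] E :=
  fderiv ℝ (chartMul (1 : G)) (φ (1 : G) 1, x) ∘L ContinuousLinearMap.inl ℝ E E

theorem chartMul_base {p : G} {x : E} (hx : x ∈ (φ p).target) :
    chartMul p (x, φ (1 : G) 1) = x := by
  simp only [chartMul, extChartAt_to_inv, mul_one, (φ p).right_inv hx]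

variable [LieGroup 𝓘(ℝ, E) ∞ G]

theorem chartMul_contDiffAt {p : G} {x y : E} (hx : x ∈ (φ p).target)
    (hy : y ∈ (φ (1 : G)).target)
    (h : (φ p).symm x * (φ (1 : G)).symm y ∈ (φ p).source) :
    ContDiffAt ℝ ∞ (chartMul p) (x, y) := by
  rw [← contMDiffAt_iff_contDiffAt]
  have h1 : ContMDiffAt 𝓘(ℝ, E × E) 𝓘(ℝ, E) ∞ (fun z : E × E ↦ (φ p).symm z.1) (x, y) :=
    ContMDiffAt.comp (x, y) (symm_contMDiffAt hx) contDiff_fst.contMDiff.contMDiffAt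
  have h2 : ContMDiffAt 𝓘(ℝ, E × E) 𝓘(ℝ, E) ∞
      (fun z : E × E ↦ (φ (1 : G)).symm z.2) (x, y) :=
    ContMDiffAt.comp (x, y) (symm_contMDiffAt hy) contDiff_snd.contMDiff.contMDiffAt
  exact ContMDiffAt.comp (x, y) (chart_contMDiffAt h) (h1.mul h2)

theorem chartMul_contDiffAt_base {p : G} {x : E} (hx : x ∈ (φ p).target) :
    ContDiffAt ℝ ∞ (chartMul p) (x, φ (1 : G) 1) := by
  refine chartMul_contDiffAt hx (mem_extChartAt_target _) ?_
  simpa using (φ p).map_target hx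

theorem leftFrame_contDiffAt {p : G} {x : E} (hx : x ∈ (φ p).target) :
    ContDiffAt ℝ ∞ (leftFrame p) x := by
  have h : ContDiffAt ℝ ∞ (fderiv ℝ (chartMul p)) (x, φ (1 : G) 1) :=
    (chartMul_contDiffAt_base hx).fderiv_right (by simp)
  have h' : ContDiffAt ℝ ∞ (fun x ↦ fderiv ℝ (chartMul p) (x, φ (1 : G) 1)) x :=
    ContDiffAt.comp x h (contDiffAt_id.prodMk contDiffAt_const)
  exact h'.clm_comp contDiffAt_const

theorem rightFrame_contDiffAt {x : E} (hx : x ∈ (φ (1 : G)).target) :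
    ContDiffAt ℝ ∞ (rightFrame G) x := by
  have h0 : ContDiffAt ℝ ∞ (chartMul (1 : G)) (φ (1 : G) 1, x) := by
    refine chartMul_contDiffAt (mem_extChartAt_target _) hx ?_
    simpa using (φ (1 : G)).map_target hx
  have h : ContDiffAt ℝ ∞ (fderiv ℝ (chartMul (1 : G))) (φ (1 : G) 1, x) :=
    h0.fderiv_right (by simp)
  have h' : ContDiffAt ℝ ∞ (fun x ↦ fderiv ℝ (chartMul (1 : G)) (φ (1 : G) 1, x)) x :=
    ContDiffAt.comp x h (contDiffAt_const.prodMk contDiffAt_id)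
  exact h'.clm_comp contDiffAt_const

theorem leftFrame_hasFDerivAt {p : G} {x : E} (hx : x ∈ (φ p).target) :
    HasFDerivAt (fun y ↦ chartMul p (x, y)) (leftFrame p x) (φ (1 : G) 1) := by
  have h := ((chartMul_contDiffAt_base hx).differentiableAt (by simp)).hasFDerivAt
  exact HasFDerivAt.comp (f := fun y ↦ (x, y)) (φ (1 : G) 1) h
    (hasFDerivAt_prodMk_right x (φ (1 : G) 1))

theorem rightFrame_hasFDerivAt {x : E} (hx : x ∈ (φ (1 : G)).target) :
    HasFDerivAt (fun y ↦ chartMul (1 : G) (y, x)) (rightFrame G x) (φ (1 : G) 1) := by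
  have h0 : ContDiffAt ℝ ∞ (chartMul (1 : G)) (φ (1 : G) 1, x) := by
    refine chartMul_contDiffAt (mem_extChartAt_target _) hx ?_
    simpa using (φ (1 : G)).map_target hx
  have h := (h0.differentiableAt (by simp)).hasFDerivAt
  exact HasFDerivAt.comp (f := fun y ↦ (y, x)) (φ (1 : G) 1) h
    (hasFDerivAt_prodMk_left (φ (1 : G) 1) x)

theorem leftFrame_one : leftFrame (1 : G) (φ (1 : G) 1) = ContinuousLinearMap.id ℝ E := by
  refine (leftFrame_hasFDerivAt (mem_extChartAt_target _)).unique ?_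
  refine (hasFDerivAt_id _).congr_of_eventuallyEq ?_
  filter_upwards [extChartAt_target_mem_nhds (I := 𝓘(ℝ, E)) (1 : G)] with y hy
  simp only [chartMul, extChartAt_to_inv, one_mul, (φ (1 : G)).right_inv hy, id_eq]

theorem rightFrame_one : rightFrame G (φ (1 : G) 1) = ContinuousLinearMap.id ℝ E := by
  refine (rightFrame_hasFDerivAt (mem_extChartAt_target _)).unique ?_
  refine (hasFDerivAt_id _).congr_of_eventuallyEq ?_
  filter_upwards [extChartAt_target_mem_nhds (I := 𝓘(ℝ, E)) (1 : G)] with y hy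
  simp only [chartMul, extChartAt_to_inv, mul_one, (φ (1 : G)).right_inv hy, id_eq]

/-- The frame is invertible, since left division in charts is a differentiable left inverse of the
multiplication `chartMul`. -/
theorem leftFrame_isUnit [FiniteDimensional ℝ E] {p : G} {x : E} (hx : x ∈ (φ p).target) :
    IsUnit (leftFrame p x) := by
  have : CompleteSpace E := FiniteDimensional.complete ℝ E
  set a := (φ p).symm x with ha
  have hbase : chartMul p (x, φ (1 : G) 1) = x := chartMul_base hx
  let d : E → E := fun z ↦ φ (1 : G) (a⁻¹ * (φ p).symm z)
  have hd : DifferentiableAt ℝ d x := by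
    refine ContDiffAt.differentiableAt (n := ∞) (contMDiffAt_iff_contDiffAt.1 ?_) (by simp)
    refine ContMDiffAt.comp x (chart_contMDiffAt ?_)
      ((contMDiffAt_const (c := a⁻¹)).mul (symm_contMDiffAt hx))
    rw [← ha, inv_mul_cancel]
    exact mem_extChartAt_source 1
  have hcomp : HasFDerivAt (fun y ↦ d (chartMul p (x, y))) (fderiv ℝ d x ∘L leftFrame p x)
      (φ (1 : G) 1) := by
    have hd' : HasFDerivAt d (fderiv ℝ d x) (chartMul p (x, φ (1 : G) 1)) := by
      rw [hbase]
      exact hd.hasFDerivAt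
    exact hd'.comp (φ (1 : G) 1) (leftFrame_hasFDerivAt hx)
  have hid : HasFDerivAt (fun y ↦ d (chartMul p (x, y))) (ContinuousLinearMap.id ℝ E)
      (φ (1 : G) 1) := by
    refine (hasFDerivAt_id _).congr_of_eventuallyEq ?_
    have hT : IsTopologicalGroup G := topologicalGroup_of_lieGroup 𝓘(ℝ, E) ∞
    have hc : ContinuousAt (fun y ↦ a * (φ (1 : G)).symm y) (φ (1 : G) 1) :=
      continuousAt_const.mul (continuousAt_extChartAt_symm (1 : G))
    have hs : ∀ᶠ y in 𝓝 (φ (1 : G) 1), a * (φ (1 : G)).symm y ∈ (φ p).source := by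
      refine hc.eventually ((isOpen_extChartAt_source p).mem_nhds ?_)
      simp only [extChartAt_to_inv, mul_one]
      exact (φ p).map_target hx
    filter_upwards [hs, extChartAt_target_mem_nhds (I := 𝓘(ℝ, E)) (1 : G)] with y hy hy'
    simp only [d, chartMul, ← ha, (φ p).left_inv hy, inv_mul_cancel_left,
      (φ (1 : G)).right_inv hy', id_eq]
  have hu := hcomp.unique hid
  have hinj : Function.Injective (leftFrame p x) := by
    refine Function.LeftInverse.injective (g := fderiv ℝ d x) fun v ↦ ?_
    exact congrArg (fun A : E →L[ℝ] E ↦ A v) hu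
  rw [ContinuousLinearMap.isUnit_iff_bijective]
  exact ⟨hinj, (LinearMap.injective_iff_surjective (f := (leftFrame p x : E →ₗ[ℝ] E))).1 hinj⟩

/-- `leftFrame p x v` is the coordinate expression of the left-invariant vector field of `v`. -/
theorem mfderiv_symm_leftFrame {p : G} {x : E} (hx : x ∈ (φ p).target) (v : E) :
    (mfderiv 𝓘(ℝ, E) 𝓘(ℝ, E) (φ p).symm x (leftFrame p x v) : E) =
      (mulInvariantVectorField (I := 𝓘(ℝ, E)) (G := G) v ((φ p).symm x) : E) := by
  set a := (φ p).symm x with ha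
  have hT : IsTopologicalGroup G := topologicalGroup_of_lieGroup 𝓘(ℝ, E) ∞
  have hbase : chartMul p (x, φ (1 : G) 1) = x := chartMul_base hx
  have h1 : HasMFDerivAt 𝓘(ℝ, E) 𝓘(ℝ, E) (φ (1 : G)) 1 (ContinuousLinearMap.id ℝ E) := by
    have := (chart_contMDiffAt (E := E) (mem_extChartAt_source (I := 𝓘(ℝ, E)) (1 : G))
      |>.mdifferentiableAt (by simp)).hasMFDerivAt
    rwa [mfderiv_extChartAt_self] at this
  have h2 : HasMFDerivAt 𝓘(ℝ, E) 𝓘(ℝ, E) (fun y : E ↦ chartMul p (x, y)) (φ (1 : G) 1)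
      (leftFrame (E := E) p x) := hasMFDerivAt_iff_hasFDerivAt.2 (leftFrame_hasFDerivAt hx)
  have h3 : HasMFDerivAt 𝓘(ℝ, E) 𝓘(ℝ, E) (φ p).symm (chartMul p (x, φ (1 : G) 1))
      (mfderiv 𝓘(ℝ, E) 𝓘(ℝ, E) (φ p).symm (chartMul p (x, φ (1 : G) 1))) := by
    refine MDifferentiableAt.hasMFDerivAt ?_
    rw [hbase]
    exact (symm_contMDiffAt hx).mdifferentiableAt (by simp)
  have h23 := HasMFDerivAt.comp (f := fun y : E ↦ chartMul p (x, y)) (φ (1 : G) 1) h3 h2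
  have h4 := HasMFDerivAt.comp (f := φ (1 : G)) 1 h23 h1
  have h5 : (fun g ↦ a * g) =ᶠ[𝓝 1]
      ((φ p).symm ∘ (fun y ↦ chartMul p (x, y))) ∘ (φ (1 : G)) := by
    have hs : ∀ᶠ g in 𝓝 (1 : G), a * g ∈ (φ p).source := by
      refine (continuous_const_mul a).continuousAt.eventually
        ((isOpen_extChartAt_source p).mem_nhds ?_)
      simp only [mul_one]
      exact (φ p).map_target hx
    filter_upwards [hs, extChartAt_source_mem_nhds (I := 𝓘(ℝ, E)) (1 : G)] with g hg hg'
    simp only [Function.comp_apply, chartMul, ← ha, (φ (1 : G)).left_inv hg',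
      (φ p).left_inv hg]
  have h6 := (h4.congr_of_eventuallyEq h5).mfderiv
  have h7 : (mulInvariantVectorField (I := 𝓘(ℝ, E)) (G := G) v a : E) =
      (mfderiv 𝓘(ℝ, E) 𝓘(ℝ, E) (φ p).symm (chartMul p (x, φ (1 : G) 1)) (leftFrame p x v) : E) := by
    unfold mulInvariantVectorField
    rw [h6]
    rfl
  rw [h7, hbase]

end Chart

/-! ### The Lie bracket in terms of the invariant frames -/

section Bracket

open Filter Set
open scoped Topology

variable {E : Type*} [NormedAddCommGroup E] [NormedSpace ℝ E]
  {G : Type*} [TopologicalSpace G] [ChartedSpace E G]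

local notation "φ" => extChartAt 𝓘(ℝ, E)

variable [Group G]

variable (G) in
/-- The bracket of the Lie algebra of `G`, on the model space `E` (the tangent space at the identity
is `E` by definition). -/
def modelBracket (v w : E) : E :=
  Bracket.bracket (L := GroupLieAlgebra 𝓘(ℝ, E) G) (M := GroupLieAlgebra 𝓘(ℝ, E) G) v w

variable [LieGroup 𝓘(ℝ, E) ∞ G]

theorem lieGroup_minSmoothness : LieGroup 𝓘(ℝ, E) (minSmoothness ℝ 3) G :=
  LieGroup.of_le (n := ∞) (by simpa using! (WithTop.coe_le_coe.2 (le_top : (3 : ℕ∞) ≤ ⊤)))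

theorem mfderiv_symm_isInvertible {p : G} {x : E} (hx : x ∈ (φ p).target) :
    (mfderiv 𝓘(ℝ, E) 𝓘(ℝ, E) (φ p).symm x).IsInvertible := by
  have h := isInvertible_mfderivWithin_extChartAt_symm (I := 𝓘(ℝ, E)) hx
  rwa [modelWithCornersSelf_coe, range_id, mfderivWithin_univ] at h

theorem mpullback_symm_mulInvariantVectorField {p : G} {x : E} (hx : x ∈ (φ p).target) (v : E) :
    (VectorField.mpullback 𝓘(ℝ, E) 𝓘(ℝ, E) (φ p).symm
      (mulInvariantVectorField (I := 𝓘(ℝ, E)) (G := G) v) x : E) = leftFrame p x v := by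
  exact (mfderiv_symm_isInvertible hx).inverse_apply_eq.2 (mfderiv_symm_leftFrame hx v).symm

theorem mfderiv_chart_self (p : G) :
    (mfderiv 𝓘(ℝ, E) 𝓘(ℝ, E) (φ p) p : E →L[ℝ] E) = ContinuousLinearMap.id ℝ E :=
  mfderiv_extChartAt_self

theorem mfderiv_symm_self (p : G) :
    (mfderiv 𝓘(ℝ, E) 𝓘(ℝ, E) (φ p).symm (φ p p) : E →L[ℝ] E) = ContinuousLinearMap.id ℝ E := by
  have h := mfderivWithin_range_extChartAt_symm (I := 𝓘(ℝ, E)) (x := p)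
  rwa [modelWithCornersSelf_coe, range_id, mfderivWithin_univ] at h

theorem leftFrame_self (p : G) (v : E) :
    leftFrame p (φ p p) v = (mulInvariantVectorField (I := 𝓘(ℝ, E)) (G := G) v p : E) := by
  have h := mfderiv_symm_leftFrame (mem_extChartAt_target (I := 𝓘(ℝ, E)) p) v
  rw [mfderiv_symm_self, extChartAt_to_inv] at h
  exact h

/-- The Lie bracket of the Lie algebra, in terms of the derivative of the left-invariant frame at
an arbitrary point `p`. -/
theorem leftFrame_lie [CompleteSpace E] (p : G) (v w : E) :
    leftFrame p (φ p p) (modelBracket G v w) =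
      fderiv ℝ (leftFrame p) (φ p p) (leftFrame p (φ p p) v) w -
        fderiv ℝ (leftFrame p) (φ p p) (leftFrame p (φ p p) w) v := by
  have hLG : LieGroup 𝓘(ℝ, E) (minSmoothness ℝ 3) G := lieGroup_minSmoothness
  have hp := mem_extChartAt_target (I := 𝓘(ℝ, E)) p
  have key (V W : GroupLieAlgebra 𝓘(ℝ, E) G) : mulInvariantVectorField ⁅V, W⁆ p =
      (mfderiv 𝓘(ℝ, E) 𝓘(ℝ, E) (φ p) p).inverse
        (VectorField.lieBracket (E := E) ℝ
          (VectorField.mpullback 𝓘(ℝ, E) 𝓘(ℝ, E) (φ p).symm (mulInvariantVectorField V))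
          (VectorField.mpullback 𝓘(ℝ, E) 𝓘(ℝ, E) (φ p).symm (mulInvariantVectorField W))
          (φ p p) : E) := by
    rw [GroupLieAlgebra.bracket_def, mulInvariantVector_mlieBracket,
      ← VectorField.mlieBracketWithin_univ, VectorField.mlieBracketWithin_apply,
      modelWithCornersSelf_coe, range_id, preimage_univ, univ_inter,
      VectorField.mpullbackWithin_univ, VectorField.mpullbackWithin_univ]
    exact congrArg _ (congrFun VectorField.lieBracketWithin_univ _)
  have hinv : ((mfderiv 𝓘(ℝ, E) 𝓘(ℝ, E) (φ p) p).inverse : E →L[ℝ] E) =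
      ContinuousLinearMap.id ℝ E := by
    rw [mfderiv_chart_self]
    exact ContinuousLinearMap.inverse_id
  have hframe (u : E) : VectorField.mpullback 𝓘(ℝ, E) 𝓘(ℝ, E) (φ p).symm
      (mulInvariantVectorField (I := 𝓘(ℝ, E)) (G := G) u) =ᶠ[𝓝 (φ p p)]
        fun x ↦ leftFrame p x u := by
    filter_upwards [(isOpen_extChartAt_target p).mem_nhds hp] with x hx
    exact mpullback_symm_mulInvariantVectorField hx u
  have hd : DifferentiableAt ℝ (leftFrame p) (φ p p) :=
    (leftFrame_contDiffAt hp).differentiableAt (by simp)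
  have hfd (u z : E) : fderiv ℝ (fun x ↦ leftFrame p x u) (φ p p) z =
      fderiv ℝ (leftFrame p) (φ p p) z u := by
    rw [fderiv_clm_apply hd (differentiableAt_const u)]
    simp
  refine (leftFrame_self p _).trans ((key v w).trans ?_)
  refine (congrArg (fun A : E →L[ℝ] E ↦ A _) hinv).trans ?_
  refine ((hframe v).lieBracket_vectorField_eq (hframe w)).trans ?_
  rw [VectorField.lieBracket_eq]
  change fderiv ℝ (fun x ↦ leftFrame p x (w : E)) (φ p p) (leftFrame p (φ p p) (v : E)) -
    fderiv ℝ (fun x ↦ leftFrame p x (v : E)) (φ p p) (leftFrame p (φ p p) (w : E)) = _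
  rw [hfd, hfd]

theorem lie_eq_fderiv_leftFrame [CompleteSpace E] (v w : E) :
    modelBracket G v w =
      (fderiv ℝ (leftFrame (1 : G)) (φ (1 : G) 1) v : E →L[ℝ] E) w -
        (fderiv ℝ (leftFrame (1 : G)) (φ (1 : G) 1) w : E →L[ℝ] E) v := by
  have h := leftFrame_lie (1 : G) v w
  rw [leftFrame_one] at h
  exact h

/-- The derivatives of the right-invariant and the left-invariant frame at the identity are
transposes of each other, since both are given by the mixed second derivative of the
multiplication. -/
theorem fderiv_rightFrame_apply (v w : E) :
    fderiv ℝ (rightFrame G) (φ (1 : G) 1) v w = fderiv ℝ (leftFrame (1 : G)) (φ (1 : G) 1) w v := by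
  have hp := mem_extChartAt_target (I := 𝓘(ℝ, E)) (1 : G)
  have hc := chartMul_contDiffAt_base hp
  set x₀ : E := φ (1 : G) 1
  have hd : HasFDerivAt (fderiv ℝ (chartMul (1 : G)))
      (fderiv ℝ (fderiv ℝ (chartMul (1 : G))) (x₀, x₀)) (x₀, x₀) :=
    ((hc.fderiv_right (m := ∞) (by simp)).differentiableAt (by simp)).hasFDerivAt
  have hL : HasFDerivAt (fun x : E ↦ fderiv ℝ (chartMul (1 : G)) (x, x₀) ∘L
      ContinuousLinearMap.inr ℝ E E) _ x₀ :=
    (HasFDerivAt.comp (f := fun x : E ↦ (x, x₀)) x₀ hd (hasFDerivAt_prodMk_left x₀ x₀)).clm_comp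
      (hasFDerivAt_const _ x₀)
  have hR : HasFDerivAt (fun x : E ↦ fderiv ℝ (chartMul (1 : G)) (x₀, x) ∘L
      ContinuousLinearMap.inl ℝ E E) _ x₀ :=
    (HasFDerivAt.comp (f := fun x : E ↦ (x₀, x)) x₀ hd (hasFDerivAt_prodMk_right x₀ x₀)).clm_comp
      (hasFDerivAt_const _ x₀)
  have hL' := hL.fderiv
  have hR' := hR.fderiv
  change fderiv ℝ (leftFrame (1 : G)) x₀ = _ at hL'
  change fderiv ℝ (rightFrame G) x₀ = _ at hR'
  rw [hL', hR']
  have h2 : minSmoothness ℝ 2 ≤ ∞ := by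
    simpa using! (WithTop.coe_le_coe.2 (le_top : (2 : ℕ∞) ≤ ⊤))
  have hs := (hc.isSymmSndFDerivAt h2).eq (0, v) (w, 0)
  simpa using hs

end Bracket

/-! ### Brackets with values in the span of their arguments -/

section LinearAlgebra

variable {V : Type*} [AddCommGroup V] [Module ℝ V]

/-- Every line of the quotient by the line of `x` is invariant under `B x`, which is therefore a
homothety of this quotient. -/
theorem exists_smul_sub_mem_span_singleton (B : V →ₗ[ℝ] V →ₗ[ℝ] V) (hB : ∀ x, B x x = 0)
    (hspan : ∀ x y, B x y ∈ Submodule.span ℝ {x, y}) (x : V) :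
    ∃ c : ℝ, ∀ y, c • y - B x y ∈ Submodule.span ℝ {x} := by
  set S := Submodule.span ℝ {x} with hS
  have hle : S ≤ S.comap (B x) := by
    rw [hS, Submodule.span_singleton_le_iff_mem, Submodule.mem_comap, hB]
    exact zero_mem _
  obtain ⟨c, hc⟩ := LinearMap.exists_eq_smul_id_of_forall_notLinearIndependent
    (f := S.mapQ S (B x) hle) fun q h ↦ by
      obtain ⟨y, rfl⟩ := S.mkQ_surjective q
      obtain ⟨s, t, hst⟩ := Submodule.mem_span_pair.1 (hspan x y)
      have h0 : t • S.mkQ y + (-1 : ℝ) • S.mapQ S (B x) hle (S.mkQ y) = 0 := by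
        have hx : S.mkQ x = 0 := by
          simp [hS]
        have hm : S.mapQ S (B x) hle (S.mkQ y) = S.mkQ (B x y) := rfl
        rw [hm, ← hst, map_add, map_smul, map_smul, hx]
        simp
      have := (LinearIndependent.pair_iff.1 h t (-1) h0).2
      norm_num at this
  refine ⟨c, fun y ↦ ?_⟩
  have h1 : S.mkQ (B x y) = c • S.mkQ y := congrArg (fun T ↦ T (S.mkQ y)) hc
  rw [← Submodule.Quotient.mk_eq_zero, Submodule.Quotient.mk_sub, sub_eq_zero]
  exact h1.symm

variable [FiniteDimensional ℝ V]

/-- The factor by which `ad x` acts modulo `x` is a multiple of the trace of `ad x`. This is why it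
depends linearly on `x`. -/
theorem trace_eq_of_smul_sub_mem_span (T : V →ₗ[ℝ] V) {x : V} (hx : x ≠ 0) (hT : T x = 0) {c : ℝ}
    (hc : ∀ y, c • y - T y ∈ Submodule.span ℝ {x}) :
    LinearMap.trace ℝ V T = (Module.finrank ℝ V - 1) * c := by
  obtain ⟨f, hf⟩ := Module.Projective.exists_dual_eq_one ℝ hx
  have hT' : T = c • LinearMap.id - (c • f - f ∘ₗ T).smulRight x := by
    ext y
    obtain ⟨t, ht⟩ := Submodule.mem_span_singleton.1 (hc y)
    have hft : t = c * f y - f (T y) := by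
      have h := congrArg f ht
      simpa [hf] using h
    have h : T y = c • y - (c * f y - f (T y)) • x := by rw [← hft, ht, sub_sub_cancel]
    exact h
  have h := congrArg (LinearMap.trace ℝ V) hT'
  rw [h, map_sub, map_smul, LinearMap.trace_id, LinearMap.trace_smulRight]
  simp [hf, hT]
  ring

theorem exists_dual_of_forall_mem_span (B : V →ₗ[ℝ] V →ₗ[ℝ] V) (hB : ∀ x, B x x = 0)
    (hspan : ∀ x y, B x y ∈ Submodule.span ℝ {x, y}) (hne : B ≠ 0) :
    1 < Module.finrank ℝ V ∧ ∃ l : V →ₗ[ℝ] ℝ, l ≠ 0 ∧ (∀ x y, B x y = l x • y - l y • x) ∧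
      ∀ x, LinearMap.trace ℝ V (B x) = (Module.finrank ℝ V - 1) * l x := by
  have hswap (x y : V) : B y x = -B x y := by
    have h := hB (x + y)
    simp only [map_add, LinearMap.add_apply, hB, zero_add, add_zero] at h
    exact eq_neg_of_add_eq_zero_left (by rw [← h, add_comm])
  have hdep (x y : V) (h : ¬ LinearIndependent ℝ ![x, y]) :
      B x y = 0 ∧ ∀ l : V →ₗ[ℝ] ℝ, l x • y - l y • x = 0 := by
    by_cases hx : x = 0
    · simp [hx]
    · rw [LinearIndependent.pair_iff' hx] at h
      push Not at h
      obtain ⟨a, rfl⟩ := h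
      refine ⟨by simp [hB], fun l ↦ ?_⟩
      simp [smul_smul, mul_comm]
  have hrank : 1 < Module.finrank ℝ V := by
    by_contra hr
    refine hne (LinearMap.ext₂ fun x y ↦ (hdep x y fun hli ↦ hr ?_).1)
    simpa [Nat.succ_le_iff] using! hli.fintype_card_le_finrank
  have hn : (Module.finrank ℝ V : ℝ) - 1 ≠ 0 := by
    have : (1 : ℝ) < Module.finrank ℝ V := by exact_mod_cast hrank
    linarith
  let l : V →ₗ[ℝ] ℝ := ((Module.finrank ℝ V : ℝ) - 1)⁻¹ • (LinearMap.trace ℝ V ∘ₗ B)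
  have hmod {x : V} (hx : x ≠ 0) (y : V) : l x • y - B x y ∈ Submodule.span ℝ {x} := by
    obtain ⟨c, hc⟩ := exists_smul_sub_mem_span_singleton B hB hspan x
    have hl : l x = c := by
      simp [l, trace_eq_of_smul_sub_mem_span (B x) hx (hB x) hc, hn]
    rw [hl]
    exact hc y
  have hform (x y : V) : B x y = l x • y - l y • x := by
    by_cases hli : LinearIndependent ℝ ![x, y]
    · have hx : x ≠ 0 := hli.ne_zero 0
      have hy : y ≠ 0 := hli.ne_zero 1
      obtain ⟨s, hs⟩ := Submodule.mem_span_singleton.1 (hmod hx y)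
      obtain ⟨t, ht⟩ := Submodule.mem_span_singleton.1 (hmod hy x)
      rw [hswap x y] at ht
      have h0 : (l y - s) • x + (l x - t) • y = 0 := by
        have : (l y - s) • x + (l x - t) • y = (l y • x - t • y) + (l x • y - s • x) := by module
        rw [this, hs, ht]
        module
      have hsl := (LinearIndependent.pair_iff.1 hli _ _ h0).1
      rw [sub_eq_zero.1 hsl, hs, sub_sub_cancel]
    · rw [(hdep x y hli).1, (hdep x y hli).2 l]
  refine ⟨hrank, l, fun h0 ↦ hne ?_, hform, fun x ↦ ?_⟩
  · ext x y
    simp [hform, h0]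
  · simp [l, hn]

end LinearAlgebra

/-! ### Maps with vanishing derivative -/

section LocallyConstant

open Filter Set
open scoped Topology

variable {E : Type*} [NormedAddCommGroup E] [NormedSpace ℝ E]
  {F : Type*} [NormedAddCommGroup F] [NormedSpace ℝ F]
  {M : Type*} [TopologicalSpace M] [ChartedSpace E M]
  {N : Type*} [TopologicalSpace N] [ChartedSpace F N]

theorem hasMFDerivAt_zero_comp {L : Type*} [TopologicalSpace L] {D : Type*} [NormedAddCommGroup D]
    [NormedSpace ℝ D] [ChartedSpace D L] {f : L → M} {g : M → N} (p : L)
    (hg : HasMFDerivAt 𝓘(ℝ, E) 𝓘(ℝ, F) g (f p) 0) (hf : MDifferentiableAt 𝓘(ℝ, D) 𝓘(ℝ, E) f p) :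
    HasMFDerivAt 𝓘(ℝ, D) 𝓘(ℝ, F) (g ∘ f) p 0 := by
  have h := hg.comp p hf.hasMFDerivAt
  rwa [ContinuousLinearMap.zero_comp] at h

theorem hasMFDerivAt_comp_zero {L : Type*} [TopologicalSpace L] {D : Type*} [NormedAddCommGroup D]
    [NormedSpace ℝ D] [ChartedSpace D L] {f : L → M} {g : M → N} (p : L)
    (hg : MDifferentiableAt 𝓘(ℝ, E) 𝓘(ℝ, F) g (f p)) (hf : HasMFDerivAt 𝓘(ℝ, D) 𝓘(ℝ, E) f p 0) :
    HasMFDerivAt 𝓘(ℝ, D) 𝓘(ℝ, F) (g ∘ f) p 0 := by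
  have h := hg.hasMFDerivAt.comp p hf
  rwa [ContinuousLinearMap.comp_zero] at h

theorem isLocallyConstant_of_hasMFDerivAt_zero [IsManifold 𝓘(ℝ, E) 1 M] [IsManifold 𝓘(ℝ, F) 1 N]
    {f : M → N}
    (hf : ∀ p, HasMFDerivAt 𝓘(ℝ, E) 𝓘(ℝ, F) f p 0) : IsLocallyConstant f := by
  rw [IsLocallyConstant.iff_eventually_eq]
  intro p
  set φ := extChartAt 𝓘(ℝ, E) p
  set ψ := extChartAt 𝓘(ℝ, F) (f p)
  let g : E → F := fun x ↦ ψ (f (φ.symm x))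
  have hU : ∀ᶠ x in 𝓝 (φ p), x ∈ φ.target ∧ f (φ.symm x) ∈ ψ.source := by
    refine Filter.Eventually.and (extChartAt_target_mem_nhds (I := 𝓘(ℝ, E)) p) ?_
    have hc : ContinuousAt (fun x ↦ f (φ.symm x)) (φ p) := by
      refine ContinuousAt.comp (g := f) (hf _).continuousAt (continuousAt_extChartAt_symm p)
    refine hc.eventually ((isOpen_extChartAt_source (f p)).mem_nhds ?_)
    simp only [φ, extChartAt_to_inv]
    exact mem_extChartAt_source (f p)
  obtain ⟨ε, hε, hball⟩ := Metric.eventually_nhds_iff_ball.1 hU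
  have hg (x : E) (hx : x ∈ Metric.ball (φ p) ε) : HasFDerivAt g (0 : E →L[ℝ] F) x := by
    obtain ⟨h1, h2⟩ := hball x hx
    have hsymm : MDifferentiableAt 𝓘(ℝ, E) 𝓘(ℝ, E) φ.symm x := by
      have := mdifferentiableWithinAt_extChartAt_symm (I := 𝓘(ℝ, E)) h1
      rwa [modelWithCornersSelf_coe, range_id, mdifferentiableWithinAt_univ] at this
    have hψ : MDifferentiableAt 𝓘(ℝ, F) 𝓘(ℝ, F) ψ (f (φ.symm x)) :=
      mdifferentiableAt_extChartAt (by rwa [← extChartAt_source 𝓘(ℝ, F)])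
    have h3 := hasMFDerivAt_comp_zero (f := f ∘ φ.symm) x hψ
      (hasMFDerivAt_zero_comp (f := φ.symm) x (hf (φ.symm x)) hsymm)
    exact hasMFDerivAt_iff_hasFDerivAt.1 h3
  have hconst (x : E) (hx : x ∈ Metric.ball (φ p) ε) : g x = g (φ p) :=
    Metric.isOpen_ball.is_const_of_fderiv_eq_zero (𝕜 := ℝ) (convex_ball (φ p) ε).isPreconnected
      (fun y hy ↦ (hg y hy).differentiableAt.differentiableWithinAt)
      (fun y hy ↦ (hg y hy).fderiv) hx (Metric.mem_ball_self hε)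
  filter_upwards [extChartAt_source_mem_nhds (I := 𝓘(ℝ, E)) p,
    (continuousAt_extChartAt (I := 𝓘(ℝ, E)) p).eventually (Metric.ball_mem_nhds _ hε)] with q hq hq'
  have h := hconst _ hq'
  simp only [g, φ, extChartAt_to_inv, PartialEquiv.left_inv _ hq] at h
  refine ψ.injOn ?_ (mem_extChartAt_source (f p)) h
  have := (hball _ hq').2
  rwa [PartialEquiv.left_inv _ hq] at this

end LocallyConstant

/-! ### The adjoint representation -/

section Adjoint

open Filter Set
open scoped Topology

variable {E : Type*} [NormedAddCommGroup E] [NormedSpace ℝ E]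

/-- The derivative of the quotient `P⁻¹ Q` at a point where both terms are `1`. -/
theorem hasFDerivAt_ringInverse_mul {R : Type*} [NormedRing R] [NormedAlgebra ℝ R]
    [HasSummableGeomSeries R] {P Q : E → R} {P' Q' : E →L[ℝ] R} {x : E} (hP : HasFDerivAt P P' x)
    (hQ : HasFDerivAt Q Q' x) (hP1 : P x = 1) (hQ1 : Q x = 1) :
    HasFDerivAt (fun y ↦ Ring.inverse (P y) * Q y) (Q' - P') x := by
  have hinv : DifferentiableAt ℝ (fun y ↦ Ring.inverse (P y)) x := by
    have h1 : DifferentiableAt ℝ (Ring.inverse : R → R) (P x) := by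
      rw [hP1]
      exact differentiableAt_inverse isUnit_one
    exact h1.comp x hP.differentiableAt
  have hJ := (hinv.mul hQ.differentiableAt).hasFDerivAt
  have hev : (fun y ↦ P y * (Ring.inverse (P y) * Q y)) =ᶠ[𝓝 x] Q := by
    have hu : ∀ᶠ y in 𝓝 x, IsUnit (P y) := by
      refine hP.continuousAt.eventually (Units.isOpen.mem_nhds ?_)
      rw [hP1]
      exact isUnit_one
    filter_upwards [hu] with y hy
    exact Ring.mul_inverse_cancel_left _ _ hy
  have heq := ((hP.mul' hJ).congr_of_eventuallyEq hev.symm).unique hQ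
  refine hJ.congr_fderiv ?_
  rw [eq_sub_iff_add_eq, ← heq]
  ext v
  simp [hP1, hQ1]

variable {G : Type*} [TopologicalSpace G] [ChartedSpace E G]

local notation "φ" => extChartAt 𝓘(ℝ, E)

variable [Group G]

/-- The adjoint representation of a Lie group: the derivative at `1` of the conjugation by `a`, in
the chart at `1`. -/
def adjoint (a : G) : E →L[ℝ] E :=
  fderiv ℝ (fun y ↦ φ (1 : G) (a * (φ (1 : G)).symm y * a⁻¹)) (φ (1 : G) 1)

theorem adjoint_one : adjoint (E := E) (1 : G) = ContinuousLinearMap.id ℝ E := by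
  refine (HasFDerivAt.congr_of_eventuallyEq (hasFDerivAt_id _) ?_).fderiv
  filter_upwards [extChartAt_target_mem_nhds (I := 𝓘(ℝ, E)) (1 : G)] with y hy
  simp only [one_mul, inv_one, mul_one, (φ (1 : G)).right_inv hy, id_eq]

variable [LieGroup 𝓘(ℝ, E) ∞ G]

theorem eventually_conj_mem_source (a : G) :
    ∀ᶠ y in 𝓝 (φ (1 : G) 1), a * (φ (1 : G)).symm y * a⁻¹ ∈ (φ (1 : G)).source := by
  have hT : IsTopologicalGroup G := topologicalGroup_of_lieGroup 𝓘(ℝ, E) ∞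
  have hc : ContinuousAt (fun y ↦ a * (φ (1 : G)).symm y * a⁻¹) (φ (1 : G) 1) :=
    (continuousAt_const.mul (continuousAt_extChartAt_symm (1 : G))).mul continuousAt_const
  refine hc.eventually ((isOpen_extChartAt_source 1).mem_nhds ?_)
  simp only [extChartAt_to_inv, mul_one, mul_inv_cancel]
  exact mem_extChartAt_source 1

theorem adjoint_hasFDerivAt (a : G) :
    HasFDerivAt (fun y ↦ φ (1 : G) (a * (φ (1 : G)).symm y * a⁻¹)) (adjoint (E := E) a)
      (φ (1 : G) 1) := by
  refine DifferentiableAt.hasFDerivAt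
    (ContDiffAt.differentiableAt (n := ∞) (contMDiffAt_iff_contDiffAt.1 ?_) (by simp))
  refine ContMDiffAt.comp (φ (1 : G) 1)
    (chart_contMDiffAt (eventually_conj_mem_source a).self_of_nhds) ?_
  exact (contMDiffAt_const.mul (symm_contMDiffAt (mem_extChartAt_target 1))).mul contMDiffAt_const

theorem adjoint_mul (a b : G) :
    adjoint (E := E) (a * b) = (adjoint a).comp (adjoint b) := by
  refine HasFDerivAt.fderiv ?_
  have ha : HasFDerivAt (fun y ↦ φ (1 : G) (a * (φ (1 : G)).symm y * a⁻¹)) (adjoint (E := E) a)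
      (φ (1 : G) (b * (φ (1 : G)).symm (φ (1 : G) 1) * b⁻¹)) := by
    simpa only [extChartAt_to_inv, mul_one, mul_inv_cancel] using adjoint_hasFDerivAt (E := E) a
  refine (ha.comp (φ (1 : G) 1) (adjoint_hasFDerivAt b)).congr_of_eventuallyEq ?_
  filter_upwards [eventually_conj_mem_source b] with y hy
  rw [Function.comp_apply, (φ (1 : G)).left_inv hy, mul_inv_rev]
  simp only [mul_assoc]

/-- Since `a b = (a b a⁻¹) a`, left-invariant fields are obtained from right-invariant ones by the
adjoint representation. -/
theorem rightFrame_comp_adjoint {x : E} (hx : x ∈ (φ (1 : G)).target) :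
    (rightFrame G x).comp (adjoint ((φ (1 : G)).symm x)) = leftFrame (1 : G) x := by
  refine HasFDerivAt.unique ?_ (leftFrame_hasFDerivAt hx)
  set a := (φ (1 : G)).symm x with ha
  have hR : HasFDerivAt (fun y ↦ chartMul (1 : G) (y, x)) (rightFrame G x)
      (φ (1 : G) (a * (φ (1 : G)).symm (φ (1 : G) 1) * a⁻¹)) := by
    simpa only [extChartAt_to_inv, mul_one, mul_inv_cancel] using rightFrame_hasFDerivAt hx
  refine (hR.comp (φ (1 : G) 1) (adjoint_hasFDerivAt a)).congr_of_eventuallyEq ?_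
  filter_upwards [eventually_conj_mem_source a] with y hy
  simp only [Function.comp_apply, chartMul, (φ (1 : G)).left_inv hy, ← ha, inv_mul_cancel_right]

theorem hasFDerivAt_adjoint_symm [CompleteSpace E] :
    HasFDerivAt (fun x ↦ adjoint ((φ (1 : G)).symm x))
      (fderiv ℝ (leftFrame (1 : G)) (φ (1 : G) 1) - fderiv ℝ (rightFrame G) (φ (1 : G) 1))
      (φ (1 : G) 1) := by
  have hp := mem_extChartAt_target (I := 𝓘(ℝ, E)) (1 : G)
  have hL := ((leftFrame_contDiffAt hp).differentiableAt (by simp)).hasFDerivAt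
  have hR := ((rightFrame_contDiffAt hp).differentiableAt (by simp)).hasFDerivAt
  refine (hasFDerivAt_ringInverse_mul hR hL rightFrame_one leftFrame_one).congr_of_eventuallyEq ?_
  have hu : ∀ᶠ x in 𝓝 (φ (1 : G) 1), IsUnit (rightFrame G x) := by
    refine (rightFrame_contDiffAt hp).continuousAt.eventually (Units.isOpen.mem_nhds ?_)
    rw [rightFrame_one]
    exact isUnit_one
  filter_upwards [hu, extChartAt_target_mem_nhds (I := 𝓘(ℝ, E)) (1 : G)] with x hx hx'
  rw [← rightFrame_comp_adjoint hx']
  exact (Ring.inverse_mul_cancel_left _ _ hx).symm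

/-- The derivative of the adjoint representation at `1` is the bracket, and by multiplicativity it
determines the derivative at every other point. -/
theorem hasMFDerivAt_adjoint_zero [CompleteSpace E] (h : ∀ v w : E, modelBracket G v w = 0)
    (a : G) : HasMFDerivAt 𝓘(ℝ, E) 𝓘(ℝ, E →L[ℝ] E) (adjoint (E := E) (G := G)) a 0 := by
  have h1 : HasMFDerivAt 𝓘(ℝ, E) 𝓘(ℝ, E →L[ℝ] E) (adjoint (E := E) (G := G)) 1 0 := by
    have hz : HasFDerivAt (fun x ↦ adjoint ((φ (1 : G)).symm x)) (0 : E →L[ℝ] E →L[ℝ] E)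
        (φ (1 : G) 1) := by
      refine hasFDerivAt_adjoint_symm.congr_fderiv ?_
      ext v w
      have := lie_eq_fderiv_leftFrame (G := G) v w
      rw [h] at this
      rw [← fderiv_rightFrame_apply v w] at this
      exact this.symm
    have hc := chart_contMDiffAt (E := E) (mem_extChartAt_source (I := 𝓘(ℝ, E)) (1 : G))
      |>.mdifferentiableAt (by simp)
    have hcomp := hasMFDerivAt_zero_comp (f := φ (1 : G)) 1 hz.hasMFDerivAt hc
    refine hcomp.congr_of_eventuallyEq ?_
    filter_upwards [extChartAt_source_mem_nhds (I := 𝓘(ℝ, E)) (1 : G)] with g hg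
    simp only [Function.comp_apply, (φ (1 : G)).left_inv hg]
  have h2 : HasMFDerivAt 𝓘(ℝ, E) 𝓘(ℝ, E →L[ℝ] E) (adjoint (E := E) (G := G)) (a⁻¹ * a) 0 := by
    rw [inv_mul_cancel]
    exact h1
  have h3 : MDifferentiableAt 𝓘(ℝ, E) 𝓘(ℝ, E) (fun b ↦ a⁻¹ * b) a :=
    (contMDiff_mul_left (n := ∞)).contMDiffAt.mdifferentiableAt (by simp)
  have h4 := hasMFDerivAt_zero_comp (f := fun b ↦ a⁻¹ * b) a h2 h3
  have h5 := hasMFDerivAt_comp_zero (f := adjoint (E := E) ∘ fun b ↦ a⁻¹ * b) a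
    (ContinuousLinearMap.compL ℝ E E E (adjoint a)).mdifferentiableAt h4
  refine h5.congr_of_eventuallyEq (Eventually.of_forall fun b ↦ ?_)
  simp [← adjoint_mul]

/-- The commutator map `k` with `a` has derivative `Ad a - 1` at the identity, and at another point
`b` its derivative is determined by this, because `k y = k b * (b * k (b⁻¹ * y) * b⁻¹)`. -/
theorem hasMFDerivAt_commutator_zero {a : G}
    (ha : adjoint (E := E) a = ContinuousLinearMap.id ℝ E) (b : G) :
    HasMFDerivAt 𝓘(ℝ, E) 𝓘(ℝ, E) (fun y : G ↦ a * y * a⁻¹ * y⁻¹) b 0 := by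
  set k : G → G := fun y ↦ a * y * a⁻¹ * y⁻¹ with hk
  have hks : ContMDiff 𝓘(ℝ, E) 𝓘(ℝ, E) ∞ k :=
    ((contMDiff_const.mul contMDiff_id).mul contMDiff_const).mul contMDiff_id.inv
  have hk1 : k 1 = 1 := by simp [hk]
  have hp := mem_extChartAt_target (I := 𝓘(ℝ, E)) (1 : G)
  have h1 : HasMFDerivAt 𝓘(ℝ, E) 𝓘(ℝ, E) k 1 0 := by
    set κ : E → E := fun y ↦ φ (1 : G) (k ((φ (1 : G)).symm y)) with hκ
    have hκ0 : κ (φ (1 : G) 1) = φ (1 : G) 1 := by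
      simp only [hκ, extChartAt_to_inv, hk1]
    have hs : ContMDiffAt 𝓘(ℝ, E) 𝓘(ℝ, E) ∞ (fun y ↦ k ((φ (1 : G)).symm y)) (φ (1 : G) 1) :=
      hks.contMDiffAt.comp (φ (1 : G) 1) (symm_contMDiffAt hp)
    have hsrc : k ((φ (1 : G)).symm (φ (1 : G) 1)) ∈ (φ (1 : G)).source := by
      rw [extChartAt_to_inv, hk1]
      exact mem_extChartAt_source 1
    have hd : HasFDerivAt κ (fderiv ℝ κ (φ (1 : G) 1)) (φ (1 : G) 1) :=
      (ContDiffAt.differentiableAt (n := ∞) (contMDiffAt_iff_contDiffAt.1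
        ((chart_contMDiffAt hsrc).comp (φ (1 : G) 1) hs)) (by simp)).hasFDerivAt
    -- `k y * y` is the conjugate `a * y * a⁻¹`; differentiate this product at the identity.
    have hm : HasFDerivAt (chartMul (1 : G))
        (fderiv ℝ (chartMul (1 : G)) (φ (1 : G) 1, φ (1 : G) 1))
        (κ (φ (1 : G) 1), φ (1 : G) 1) := by
      rw [hκ0]
      exact ((chartMul_contDiffAt_base hp).differentiableAt (by simp)).hasFDerivAt
    have hprod := HasFDerivAt.comp (f := fun y ↦ (κ y, y)) (φ (1 : G) 1) hm
      (hd.prodMk (hasFDerivAt_id _))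
    have hAd := adjoint_hasFDerivAt (E := E) a
    rw [ha] at hAd
    have hzero : fderiv ℝ κ (φ (1 : G) 1) = 0 := by
      have heq := (hprod.congr_of_eventuallyEq (f₁ := fun y ↦
        φ (1 : G) (a * (φ (1 : G)).symm y * a⁻¹)) ?_).unique hAd
      · ext v
        have hv := congrArg (fun A : E →L[ℝ] E ↦ A v) heq
        have hsplit : (fderiv ℝ κ (φ (1 : G) 1) v, v) =
            ContinuousLinearMap.inl ℝ E E (fderiv ℝ κ (φ (1 : G) 1) v) +
              ContinuousLinearMap.inr ℝ E E v := by simp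
        have hl (u : E) := congrArg (fun A : E →L[ℝ] E ↦ A u) (leftFrame_one (E := E) (G := G))
        have hr (u : E) := congrArg (fun A : E →L[ℝ] E ↦ A u) (rightFrame_one (E := E) (G := G))
        change fderiv ℝ (chartMul (1 : G)) (φ (1 : G) 1, φ (1 : G) 1)
          (fderiv ℝ κ (φ (1 : G) 1) v, v) = v at hv
        rw [hsplit, map_add] at hv
        refine add_eq_right.1 (Eq.trans ?_ hv)
        exact (congrArg₂ (· + ·) (hr (fderiv ℝ κ (φ (1 : G) 1) v)) (hl v)).symm
      · filter_upwards [hs.continuousAt.eventually ((isOpen_extChartAt_source 1).mem_nhds hsrc)]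
          with y hy
        simp only [Function.comp_apply, chartMul, hκ, (φ (1 : G)).left_inv hy]
        simp only [hk, inv_mul_cancel_right]
    rw [hzero] at hd
    have hsymm : MDifferentiableAt 𝓘(ℝ, E) 𝓘(ℝ, E) (φ (1 : G)).symm (κ (φ (1 : G) 1)) := by
      rw [hκ0]
      exact (symm_contMDiffAt hp).mdifferentiableAt (by simp)
    have hc := chart_contMDiffAt (E := E) (mem_extChartAt_source (I := 𝓘(ℝ, E)) (1 : G))
      |>.mdifferentiableAt (by simp)
    refine (hasMFDerivAt_zero_comp (f := φ (1 : G)) 1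
      (hasMFDerivAt_comp_zero (f := κ) (φ (1 : G) 1) hsymm hd.hasMFDerivAt) hc
      ).congr_of_eventuallyEq ?_
    have hk1' : ∀ᶠ y in 𝓝 (1 : G), k y ∈ (φ (1 : G)).source := by
      refine hks.continuous.continuousAt.eventually ((isOpen_extChartAt_source 1).mem_nhds ?_)
      rw [hk1]
      exact mem_extChartAt_source 1
    filter_upwards [extChartAt_source_mem_nhds (I := 𝓘(ℝ, E)) (1 : G), hk1'] with y hy hy'
    simp only [Function.comp_apply, hκ, (φ (1 : G)).left_inv hy, (φ (1 : G)).left_inv hy']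
  have h2 : HasMFDerivAt 𝓘(ℝ, E) 𝓘(ℝ, E) k (b⁻¹ * b) 0 := by
    rw [inv_mul_cancel]
    exact h1
  have h3 : MDifferentiableAt 𝓘(ℝ, E) 𝓘(ℝ, E) (fun y ↦ b⁻¹ * y) b :=
    (contMDiff_mul_left (n := ∞)).contMDiffAt.mdifferentiableAt (by simp)
  have h4 := hasMFDerivAt_zero_comp (f := fun y ↦ b⁻¹ * y) b h2 h3
  have h5 : ContMDiff 𝓘(ℝ, E) 𝓘(ℝ, E) ∞ (fun y ↦ k b * (b * y * b⁻¹)) :=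
    contMDiff_const.mul ((contMDiff_const.mul contMDiff_id).mul contMDiff_const)
  have h6 := hasMFDerivAt_comp_zero (f := k ∘ fun y ↦ b⁻¹ * y) b
    (h5.contMDiffAt.mdifferentiableAt (by simp)) h4
  refine h6.congr_of_eventuallyEq (Eventually.of_forall fun y ↦ ?_)
  simp only [Function.comp_apply, hk]
  group

theorem commute_of_forall_modelBracket_eq_zero [CompleteSpace E]
    (h : ∀ v w : E, modelBracket G v w = 0) {a b : G}
    (ha : a ∈ connectedComponent (1 : G)) (hb : b ∈ connectedComponent (1 : G)) :
    a * b = b * a := by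
  -- `Ad` is locally constant, hence trivial on the identity component
  have hAd : adjoint (E := E) a = ContinuousLinearMap.id ℝ E := by
    rw [← adjoint_one (E := E) (G := G)]
    exact (isLocallyConstant_of_hasMFDerivAt_zero (hasMFDerivAt_adjoint_zero h)
      ).apply_eq_of_isPreconnected isPreconnected_connectedComponent ha mem_connectedComponent
  have hk := (isLocallyConstant_of_hasMFDerivAt_zero (hasMFDerivAt_commutator_zero hAd)
    ).apply_eq_of_isPreconnected isPreconnected_connectedComponent hb mem_connectedComponent
  simp only [mul_one, mul_inv_cancel, inv_one] at hk
  rw [mul_inv_eq_one, mul_inv_eq_iff_eq_mul] at hk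
  exact hk

end Adjoint

/-! ### Left-invariant metrics and their geodesics -/

section Metric

open Filter Set
open scoped Topology

variable {E : Type*} [NormedAddCommGroup E] [NormedSpace ℝ E]
  {G : Type*} [TopologicalSpace G] [ChartedSpace E G]

local notation "φ" => extChartAt 𝓘(ℝ, E)

variable [Group G] [LieGroup 𝓘(ℝ, E) ∞ G]

/-- The scalar product `μ(e)` on the model space `E`. -/
def PseudoRiemannianMetric.scalar (μ : PseudoRiemannianMetric E G) : E →L[ℝ] E →L[ℝ] ℝ :=
  μ.inner 1

variable {μ : PseudoRiemannianMetric E G}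

theorem PseudoRiemannianMetric.scalar_symm (v w : E) : μ.scalar v w = μ.scalar w v :=
  μ.symm 1 v w

theorem PseudoRiemannianMetric.eq_zero_of_scalar {v : E} (h : ∀ w, μ.scalar v w = 0) : v = 0 :=
  μ.nondegenerate 1 v h

theorem PseudoRiemannianMetric.inner_congr {p q : G} (h : p = q) (v w : E) :
    μ.inner p (v : E) (w : E) = μ.inner q (v : E) (w : E) := by
  subst h
  rfl

/-- A left-invariant metric is constant in the left-invariant frame. -/
theorem PseudoRiemannianMetric.IsLeftInvariant.coeff_leftFrame (hμ : μ.IsLeftInvariant) {p : G}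
    {x : E} (hx : x ∈ (φ p).target) (v w : E) :
    μ.coeff p (leftFrame p x v) (leftFrame p x w) x = μ.scalar v w := by
  have h := hμ ((φ p).symm x) 1 v w
  refine Eq.trans ?_ h
  refine Eq.trans ?_ (PseudoRiemannianMetric.inner_congr (mul_one ((φ p).symm x)).symm _ _)
  unfold PseudoRiemannianMetric.coeff
  exact congrArg₂ (fun a b : E ↦ μ.inner ((φ p).symm x) a b) (mfderiv_symm_leftFrame hx v)
    (mfderiv_symm_leftFrame hx w)

variable [FiniteDimensional ℝ E]

theorem PseudoRiemannianMetric.IsLeftInvariant.coeff_eq (hμ : μ.IsLeftInvariant) {p : G}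
    {x : E} (hx : x ∈ (φ p).target) (v w : E) :
    μ.coeff p v w x =
      μ.scalar (Ring.inverse (leftFrame p x) v) (Ring.inverse (leftFrame p x) w) := by
  have h (z : E) : leftFrame p x (Ring.inverse (leftFrame p x) z) = z :=
    congrArg (fun A : E →L[ℝ] E ↦ A z) (Ring.mul_inverse_cancel _ (leftFrame_isUnit hx))
  rw [← hμ.coeff_leftFrame hx, h, h]

theorem inverse_leftFrame_differentiableAt {p : G} {x : E} (hx : x ∈ (φ p).target) :
    DifferentiableAt ℝ (fun y ↦ Ring.inverse (leftFrame p y)) x := by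
  have : CompleteSpace E := FiniteDimensional.complete ℝ E
  have h1 : DifferentiableAt ℝ (Ring.inverse : (E →L[ℝ] E) → E →L[ℝ] E) (leftFrame p x) :=
    differentiableAt_inverse (leftFrame_isUnit hx)
  exact h1.comp x ((leftFrame_contDiffAt hx).differentiableAt (by simp))

theorem inverse_leftFrame_apply {p : G} {x : E} (hx : x ∈ (φ p).target) (v : E) :
    Ring.inverse (leftFrame p x) (leftFrame p x v) = v :=
  congrArg (fun A : E →L[ℝ] E ↦ A v) (Ring.inverse_mul_cancel _ (leftFrame_isUnit hx))

theorem fderiv_inverse_leftFrame_apply {p : G} {x : E} (hx : x ∈ (φ p).target) (z v : E) :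
    fderiv ℝ (fun y ↦ Ring.inverse (leftFrame p y)) x z (leftFrame p x v) =
      -Ring.inverse (leftFrame p x) (fderiv ℝ (leftFrame p) x z v) := by
  have hN := (inverse_leftFrame_differentiableAt hx).hasFDerivAt
  have hL := ((leftFrame_contDiffAt hx).differentiableAt (by simp)).hasFDerivAt
  have h1 := hN.clm_apply (hL.clm_apply (hasFDerivAt_const v x))
  have h2 : HasFDerivAt (fun y ↦ Ring.inverse (leftFrame p y) (leftFrame p y v))
      (0 : E →L[ℝ] E) x := by
    refine (hasFDerivAt_const v x).congr_of_eventuallyEq ?_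
    filter_upwards [(isOpen_extChartAt_target p).mem_nhds hx] with y hy
    exact inverse_leftFrame_apply hy v
  have h := congrArg (fun A : E →L[ℝ] E ↦ A z) (h1.unique h2)
  simp at h
  exact eq_neg_of_add_eq_zero_right h

theorem PseudoRiemannianMetric.IsLeftInvariant.fderiv_coeff (hμ : μ.IsLeftInvariant) {p : G}
    {x : E} (hx : x ∈ (φ p).target) (v w z : E) :
    fderiv ℝ (μ.coeff p v w) x z =
      μ.scalar (fderiv ℝ (fun y ↦ Ring.inverse (leftFrame p y)) x z v)
          (Ring.inverse (leftFrame p x) w) +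
        μ.scalar (Ring.inverse (leftFrame p x) v)
          (fderiv ℝ (fun y ↦ Ring.inverse (leftFrame p y)) x z w) := by
  have hN := (inverse_leftFrame_differentiableAt hx).hasFDerivAt
  have h1 (v : E) := hN.clm_apply (hasFDerivAt_const v x)
  have h2 := (μ.scalar.hasFDerivAt.comp x (h1 v)).clm_apply (h1 w)
  have h3 : μ.coeff p v w =ᶠ[𝓝 x] fun y ↦
      μ.scalar (Ring.inverse (leftFrame p y) v) (Ring.inverse (leftFrame p y) w) := by
    filter_upwards [(isOpen_extChartAt_target p).mem_nhds hx] with y hy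
    exact hμ.coeff_eq hy v w
  rw [(h2.congr_of_eventuallyEq h3).fderiv]
  simp
  ring

/-- The scalar product `⟨D, γ'⟩` of the velocity of a curve with the left-invariant vector field `D`
extending `d`. -/
def PseudoRiemannianMetric.momentum (μ : PseudoRiemannianMetric E G) (γ : ℝ → G) (d : E)
    (s : ℝ) : ℝ :=
  μ.inner (γ s) (mulInvariantVectorField (I := 𝓘(ℝ, E)) (G := G) d (γ s))
    (mfderiv 𝓘(ℝ, ℝ) 𝓘(ℝ, E) γ s (1 : ℝ))

theorem PseudoRiemannianMetric.IsLeftInvariant.momentum_eq (hμ : μ.IsLeftInvariant) {γ : ℝ → G}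
    (hγ : ContMDiff 𝓘(ℝ, ℝ) 𝓘(ℝ, E) ∞ γ) (d : E) {p : G} {s : ℝ} (hs : γ s ∈ (φ p).source) :
    μ.momentum γ d s = μ.scalar d
      (Ring.inverse (leftFrame p (φ p (γ s))) (deriv (fun r ↦ φ p (γ r)) s)) := by
  set x := φ p (γ s) with hx
  have hxt : x ∈ (φ p).target := (φ p).map_source hs
  have hγs : (φ p).symm x = γ s := (φ p).left_inv hs
  have hc : HasDerivAt (fun r ↦ φ p (γ r)) (deriv (fun r ↦ φ p (γ r)) s) s := by
    refine DifferentiableAt.hasDerivAt (ContDiffAt.differentiableAt (n := ∞)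
      (contMDiffAt_iff_contDiffAt.1 ?_) (by simp))
    exact (chart_contMDiffAt hs).comp s hγ.contMDiffAt
  have hv : (mfderiv 𝓘(ℝ, ℝ) 𝓘(ℝ, E) γ s (1 : ℝ) : E) =
      (mfderiv 𝓘(ℝ, E) 𝓘(ℝ, E) (φ p).symm x (deriv (fun r ↦ φ p (γ r)) s) : E) := by
    have h1 : HasMFDerivAt 𝓘(ℝ, E) 𝓘(ℝ, E) (φ p).symm (φ p (γ s))
        (mfderiv 𝓘(ℝ, E) 𝓘(ℝ, E) (φ p).symm (φ p (γ s))) :=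
      ((symm_contMDiffAt hxt).mdifferentiableAt (by simp)).hasMFDerivAt
    have h2 := HasMFDerivAt.comp (f := fun r ↦ φ p (γ r)) s h1 hc.hasFDerivAt.hasMFDerivAt
    have h3 : γ =ᶠ[𝓝 s] (φ p).symm ∘ fun r ↦ φ p (γ r) := by
      filter_upwards [hγ.continuous.continuousAt.eventually
        ((isOpen_extChartAt_source p).mem_nhds hs)] with r hr
      exact ((φ p).left_inv hr).symm
    rw [(h2.congr_of_eventuallyEq h3).mfderiv]
    refine congrArg (mfderiv 𝓘(ℝ, E) 𝓘(ℝ, E) (φ p).symm (φ p (γ s)) : E → E) ?_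
    exact one_smul ℝ _
  have h4 := hμ.coeff_eq hxt (leftFrame p x d) (deriv (fun r ↦ φ p (γ r)) s)
  rw [inverse_leftFrame_apply hxt] at h4
  rw [← h4]
  unfold PseudoRiemannianMetric.momentum PseudoRiemannianMetric.coeff
  refine Eq.trans ?_ (PseudoRiemannianMetric.inner_congr hγs.symm _ _)
  refine congrArg₂ (fun a b : E ↦ μ.inner (γ s) a b) ?_ hv
  refine Eq.trans ?_ (mfderiv_symm_leftFrame hxt d).symm
  rw [hγs]

/-- Along a geodesic, the derivative of the momentum `⟨D, γ'⟩` is `⟨∇_{γ'} D, γ'⟩`, that is half the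
Lie derivative of the metric along `D`, evaluated on `γ'`. As `[d, u] = -l u • d` and the metric is
left-invariant, this is `⟨d, u⟩ l u = (l u) ^ 2`, where `u` corresponds to `γ'` in the
left-invariant frame. -/
theorem PseudoRiemannianMetric.IsLeftInvariant.hasDerivAt_momentum (hμ : μ.IsLeftInvariant)
    {γ : ℝ → G} (hγ : μ.IsGeodesic γ) {d : E} {l : E →ₗ[ℝ] ℝ}
    (hl : ∀ v w : E, modelBracket G v w = l v • w - l w • v) (hld : l d = 0)
    (hd : ∀ v, μ.scalar d v = l v) (t : ℝ) :
    HasDerivAt (μ.momentum γ d) (μ.momentum γ d t ^ 2) t := by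
  have : CompleteSpace E := FiniteDimensional.complete ℝ E
  set p := γ t with hp
  set c : ℝ → E := fun s ↦ φ p (γ s) with hc
  have hx : c t ∈ (φ p).target := mem_extChartAt_target p
  have hcs : ContDiffAt ℝ ∞ c t := by
    refine contMDiffAt_iff_contDiffAt.1 ?_
    exact (chart_contMDiffAt (mem_extChartAt_source p)).comp t hγ.1.contMDiffAt
  have hc1 : HasDerivAt c (deriv c t) t := (hcs.differentiableAt (by simp)).hasDerivAt
  have hc2 : HasDerivAt (deriv c) (deriv (deriv c) t) t := by
    refine (ContDiffAt.differentiableAt (n := ∞) ?_ (by simp)).hasDerivAt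
    have h := (hcs.fderiv_right (m := ∞) (by simp)).clm_apply (contDiffAt_const (c := (1 : ℝ)))
    exact h
  have hev : μ.momentum γ d =ᶠ[𝓝 t] fun s ↦
      μ.scalar d (Ring.inverse (leftFrame p (c s)) (deriv c s)) := by
    filter_upwards [hγ.1.continuous.continuousAt.eventually
      ((isOpen_extChartAt_source p).mem_nhds (mem_extChartAt_source (I := 𝓘(ℝ, E)) p))] with s hs
    exact hμ.momentum_eq hγ.1 d hs
  set N : E → E →L[ℝ] E := fun y ↦ Ring.inverse (leftFrame p y) with hN
  set N' := fderiv ℝ N (c t) with hN'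
  have hNd : HasFDerivAt N N' (c t) := (inverse_leftFrame_differentiableAt hx).hasFDerivAt
  have hf : HasDerivAt (fun s ↦ μ.scalar d (N (c s) (deriv c s)))
      (μ.scalar d (N' (deriv c t) (deriv c t) + N (c t) (deriv (deriv c) t))) t :=
    (μ.scalar d).hasFDerivAt.comp_hasDerivAt t ((hNd.comp_hasDerivAt t hc1).clm_apply hc2)
  set u := N (c t) (deriv c t) with hu
  have hcu : deriv c t = leftFrame p (c t) u :=
    (congrArg (fun A : E →L[ℝ] E ↦ A (deriv c t))
      (Ring.mul_inverse_cancel _ (leftFrame_isUnit hx))).symm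
  have hmt : μ.momentum γ d t = l u := hev.self_of_nhds.trans (hd _)
  -- the geodesic equation, paired with the value of `D`
  have hgeo := hγ.2 t (leftFrame p (c t) d)
  change μ.coeff p (deriv (deriv c) t) (leftFrame p (c t) d) (c t) +
    μ.christoffel p (deriv c t) (deriv c t) (leftFrame p (c t) d) (c t) = 0 at hgeo
  have hNL : N (c t) (leftFrame p (c t) d) = d := inverse_leftFrame_apply hx d
  rw [PseudoRiemannianMetric.christoffel, hμ.fderiv_coeff hx, hμ.fderiv_coeff hx,
    hμ.coeff_eq hx] at hgeo
  change μ.scalar (N (c t) (deriv (deriv c) t)) (N (c t) (leftFrame p (c t) d)) +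
    (μ.scalar (N' (deriv c t) (deriv c t)) (N (c t) (leftFrame p (c t) d)) +
      μ.scalar u (N' (deriv c t) (leftFrame p (c t) d)) +
      (μ.scalar (N' (deriv c t) (deriv c t)) (N (c t) (leftFrame p (c t) d)) +
      μ.scalar u (N' (deriv c t) (leftFrame p (c t) d))) -
      (μ.scalar (N' (leftFrame p (c t) d) (deriv c t)) u +
      μ.scalar u (N' (leftFrame p (c t) d) (deriv c t)))) / 2 = 0 at hgeo
  rw [hNL] at hgeo
  -- the antisymmetric part of `N'` is the bracket of the Lie algebra
  have hbr : N' (leftFrame p (c t) d) (deriv c t) - N' (deriv c t) (leftFrame p (c t) d) =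
      l u • d := by
    have h1 := fderiv_inverse_leftFrame_apply hx (leftFrame p (c t) d) u
    have h2 := fderiv_inverse_leftFrame_apply hx (leftFrame p (c t) u) d
    have h3 := leftFrame_lie p d u
    have h4 := congrArg (Ring.inverse (leftFrame p (c t)) : E →L[ℝ] E) h3
    rw [map_sub] at h4
    have h5 := inverse_leftFrame_apply hx (modelBracket G d u)
    rw [hcu]
    change N' (leftFrame p (c t) d) (leftFrame p (c t) u) = _ at h1
    change N' (leftFrame p (c t) u) (leftFrame p (c t) d) = _ at h2
    rw [h1, h2]
    have h6 := h5.symm.trans h4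
    rw [hl, hld, zero_smul, zero_sub] at h6
    have h7 := congrArg (fun z ↦ -z) h6
    simp only [neg_neg, neg_sub] at h7
    rw [h7]
    change _ = N (c t) (fderiv ℝ (leftFrame p) (c t) (leftFrame p (c t) u) d) -
      N (c t) (fderiv ℝ (leftFrame p) (c t) (leftFrame p (c t) d) u)
    abel
  have hval : μ.scalar d (N' (deriv c t) (deriv c t) + N (c t) (deriv (deriv c) t)) = l u ^ 2 := by
    have h1 := congrArg (μ.scalar u) hbr
    rw [map_sub, map_smul, smul_eq_mul, PseudoRiemannianMetric.scalar_symm u d, hd u] at h1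
    rw [PseudoRiemannianMetric.scalar_symm (N' (leftFrame p (c t) d) (deriv c t)) u,
      PseudoRiemannianMetric.scalar_symm _ d, PseudoRiemannianMetric.scalar_symm _ d] at hgeo
    rw [map_add]
    linarith
  rw [hmt, ← hval]
  exact hf.congr_of_eventuallyEq hev

end Metric

/-- A solution of the Riccati equation `f' = f ^ 2` with a positive value blows up in finite
time. -/
theorem not_forall_hasDerivAt_sq {f : ℝ → ℝ} (hf : ∀ t, HasDerivAt f (f t ^ 2) t)
    (h0 : f 0 = 1) : False := by
  have hmono : Monotone f := monotone_of_deriv_nonneg (fun t ↦ (hf t).differentiableAt) fun t ↦ by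
    rw [(hf t).deriv]
    positivity
  have hpos (t : ℝ) (ht : 0 ≤ t) : 0 < f t := by
    have := hmono ht
    linarith
  -- `t + 1 / f t` is constant for `t ≥ 0`, so that `1 / f` vanishes at `t = 1`
  have hd (t : ℝ) (ht : 0 ≤ t) : HasDerivAt (fun s ↦ s + (f s)⁻¹) 0 t := by
    have h := (hasDerivAt_id t).add ((hf t).inv (hpos t ht).ne')
    refine h.congr_deriv ?_
    have := (hpos t ht).ne'
    field_simp
    ring
  have hc := constant_of_has_deriv_right_zero (f := fun s ↦ s + (f s)⁻¹) (a := 0) (b := 1)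
    (fun t ht ↦ (hd t ht.1).continuousAt.continuousWithinAt)
    (fun t ht ↦ (hd t ht.1).hasDerivWithinAt) 1 (by simp)
  simp [h0] at hc
  exact (hpos 1 zero_le_one).ne' hc

/-! ### The class `𝒞` -/

section ClassC

variable {E : Type*} [NormedAddCommGroup E] [NormedSpace ℝ E]
  {G : Type*} [TopologicalSpace G] [ChartedSpace E G] [Group G] [LieGroup 𝓘(ℝ, E) ∞ G]

local notation "φ" => extChartAt 𝓘(ℝ, E)

variable {μ : PseudoRiemannianMetric E G} {l : E →ₗ[ℝ] ℝ}

/-- The derived ideal is the kernel of `l`. If the metric is degenerate on it, then its radical is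
its orthogonal complement, so that `l` is the scalar product with an element of `ker l`. -/
theorem PseudoRiemannianMetric.IsDegenerateOnDerivedIdeal.exists_dual_vector
    (hμ : μ.IsDegenerateOnDerivedIdeal)
    (hl : ∀ v w : E, modelBracket G v w = l v • w - l w • v) (hl0 : l ≠ 0) :
    ∃ d : E, l d = 0 ∧ ∀ v, μ.scalar d v = l v := by
  obtain ⟨x, hx⟩ : ∃ x, l x = 1 := by
    obtain ⟨y, hy⟩ : ∃ y, l y ≠ 0 := by
      by_contra! h
      exact hl0 (LinearMap.ext h)
    exact ⟨(l y)⁻¹ • y, by simp [hy]⟩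
  obtain ⟨e, hle, he0, heb⟩ : ∃ e : E, l e = 0 ∧ e ≠ 0 ∧ ∀ y, l y = 0 → μ.scalar e y = 0 := by
    obtain ⟨e, he, he0, heb⟩ := hμ
    have hker (y : E) (hy : l y = 0) : y ∈ derivedIdeal E G := by
      refine Submodule.subset_span ⟨x, y, ?_⟩
      refine (hl x y).trans ?_
      simp [hx, hy]
    have hbr (v w : E) : l (modelBracket G v w) = 0 := by
      rw [hl, map_sub, map_smul, map_smul, smul_eq_mul, smul_eq_mul, mul_comm, sub_self]
    have hker' : derivedIdeal E G ≤ LinearMap.ker l := by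
      refine Submodule.span_le.2 ?_
      rintro z ⟨v, w, rfl⟩
      exact hbr v w
    exact ⟨e, hker' he, he0, fun y hy ↦ heb y (hker y hy)⟩
  have hscal (y : E) : μ.scalar e y = l y * μ.scalar e x := by
    have h0 : μ.scalar e (y - l y • x) = 0 := heb _ (by simp [hx])
    rw [map_sub, map_smul, smul_eq_mul, sub_eq_zero] at h0
    exact h0
  have hc : μ.scalar e x ≠ 0 := fun h0 ↦
    he0 (PseudoRiemannianMetric.eq_zero_of_scalar (μ := μ) fun w ↦ by rw [hscal, h0, mul_zero])
  refine ⟨(μ.scalar e x)⁻¹ • e, ?_, fun v ↦ ?_⟩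
  · rw [map_smul, hle, smul_zero]
  · rw [map_smul, smul_apply, hscal v, smul_eq_mul]
    field_simp

/-- The Levi-Civita product is `u v = ⟨u, v⟩ d - l v • u`. -/
theorem PseudoRiemannianMetric.isFlatLeftInvariant_of_dual_vector
    (hl : ∀ v w : E, modelBracket G v w = l v • w - l w • v) {d : E} (hld : l d = 0)
    (hd : ∀ v, μ.scalar d v = l v) : μ.IsFlatLeftInvariant := by
  let P : E → E → E := fun u v ↦ μ.scalar u v • d - l v • u
  have hlc (u v w : E) : 2 * μ.scalar (P u v) w = μ.scalar (modelBracket G u v) w -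
      μ.scalar (modelBracket G v w) u + μ.scalar (modelBracket G w u) v := by
    simp only [P, hl, map_sub, map_smul, sub_apply,
      smul_apply, smul_eq_mul, hd]
    rw [PseudoRiemannianMetric.scalar_symm w u, PseudoRiemannianMetric.scalar_symm w v,
      PseudoRiemannianMetric.scalar_symm v u]
    ring
  have hflat (u v w : E) : P (modelBracket G u v) w - (P u (P v w) - P v (P u w)) = 0 := by
    have hdr (z : E) : μ.scalar z d = l z := by rw [PseudoRiemannianMetric.scalar_symm, hd]
    simp only [P, hl, map_sub, map_smul, sub_apply,
      smul_apply, smul_eq_mul, hdr, hld]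
    rw [PseudoRiemannianMetric.scalar_symm v u]
    module
  exact ⟨P, hlc, hflat⟩

variable (E G) in
/-- The adjoint representation `ad` of the Lie algebra of `G`, on the model space. -/
def modelAd : E →ₗ[ℝ] E →ₗ[ℝ] E :=
  LinearMap.mk₂ ℝ
    (fun v w ↦ fderiv ℝ (leftFrame (1 : G)) (φ (1 : G) 1) v w -
      fderiv ℝ (leftFrame (1 : G)) (φ (1 : G) 1) w v)
    (fun u v w ↦ by simp only [map_add, add_apply]; abel)
    (fun a v w ↦ by simp only [map_smul, smul_apply, smul_sub])
    (fun u v w ↦ by simp only [map_add, add_apply]; abel)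
    (fun a v w ↦ by simp only [map_smul, smul_apply, smul_sub])

variable [FiniteDimensional ℝ E]

theorem modelAd_apply (v w : E) : modelAd E G v w = modelBracket G v w := by
  have : CompleteSpace E := FiniteDimensional.complete ℝ E
  exact (lie_eq_fderiv_leftFrame v w).symm

/-- The Lie algebra of a group in the class `𝒞` is determined by a nonzero linear form `l`, via
`[v, w] = l v • w - l w • v`. -/
theorem IsInClassC.exists_form (hG : IsInClassC E G) :
    1 < Module.finrank ℝ E ∧ ∃ l : E →ₗ[ℝ] ℝ, l ≠ 0 ∧
      (∀ v w : E, modelBracket G v w = l v • w - l w • v) ∧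
      ∀ v, LinearMap.trace ℝ E (modelAd E G v) = (Module.finrank ℝ E - 1) * l v := by
  have : CompleteSpace E := FiniteDimensional.complete ℝ E
  obtain ⟨hrank, l, hl, hform, htr⟩ := exists_dual_of_forall_mem_span (modelAd E G)
    (fun v ↦ by simp [modelAd]) (fun v w ↦ by rw [modelAd_apply]; exact hG.bracket_mem_span v w)
    (fun h0 ↦ by
      obtain ⟨a, ha, b, hb, hab⟩ := hG.noncommutative
      refine hab (commute_of_forall_modelBracket_eq_zero (E := E) (fun v w ↦ ?_) ha hb)
      rw [← modelAd_apply, h0]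
      rfl)
  exact ⟨hrank, l, hl, fun v w ↦ by rw [← modelAd_apply, hform], htr⟩

theorem PseudoRiemannianMetric.IsLeftInvariant.not_isGeodesicallyComplete
    (hμ : μ.IsLeftInvariant) (hl : ∀ v w : E, modelBracket G v w = l v • w - l w • v)
    (hl0 : l ≠ 0) {d : E} (hld : l d = 0) (hd : ∀ v, μ.scalar d v = l v) :
    ¬ μ.IsGeodesicallyComplete := by
  intro hcomplete
  obtain ⟨x, hx⟩ : ∃ x, l x = 1 := by
    obtain ⟨y, hy⟩ : ∃ y, l y ≠ 0 := by
      by_contra! h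
      exact hl0 (LinearMap.ext h)
    exact ⟨(l y)⁻¹ • y, by simp [hy]⟩
  obtain ⟨γ, hγ, hγ0⟩ := hcomplete ⟨(1 : G), x⟩
  refine not_forall_hasDerivAt_sq (fun t ↦ hμ.hasDerivAt_momentum hγ hl hld hd t) ?_
  let F : TangentBundle 𝓘(ℝ, E) G → ℝ := fun v ↦
    μ.inner v.1 (mulInvariantVectorField (I := 𝓘(ℝ, E)) (G := G) d v.1) v.2
  have hF := congrArg F hγ0
  refine hF.trans ?_
  have h1 : (mulInvariantVectorField (I := 𝓘(ℝ, E)) (G := G) d 1 : E) = d := by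
    rw [← leftFrame_self, leftFrame_one]
    rfl
  change μ.scalar (mulInvariantVectorField (I := 𝓘(ℝ, E)) (G := G) d 1 : E) x = 1
  rw [h1, hd, hx]

end ClassC

/-! ### Integrals of derivatives along measure-preserving families -/

section Divergence

open Filter Set
open scoped Topology

variable {E : Type*} [NormedAddCommGroup E] [NormedSpace ℝ E]
  {M : Type*} [TopologicalSpace M] [ChartedSpace E M]

theorem isCompact_symm_image {p : M} {K : Set E} (hK : IsCompact K)
    (hKt : K ⊆ (extChartAt 𝓘(ℝ, E) p).target) :
    IsCompact ((extChartAt 𝓘(ℝ, E) p).symm '' K) ∧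
      (extChartAt 𝓘(ℝ, E) p).symm '' K ⊆ (extChartAt 𝓘(ℝ, E) p).source := by
  refine ⟨hK.image_of_continuousOn ((continuousOn_extChartAt_symm p).mono hKt), ?_⟩
  rintro _ ⟨x, hx, rfl⟩
  exact (extChartAt 𝓘(ℝ, E) p).map_target (hKt hx)

variable [T2Space M] [MeasurableSpace M] [BorelSpace M]

/-- A function with compact support in the target of a chart, continuous there, gives an integrable
function on the source of the chart. -/
theorem integrableOn_source_of_compact_support {ν : Measure M} [IsFiniteMeasureOnCompacts ν] {p : M}
    {g : E → ℝ} {K : Set E} (hK : IsCompact K) (hKt : K ⊆ (extChartAt 𝓘(ℝ, E) p).target)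
    (hg : ContinuousOn g (extChartAt 𝓘(ℝ, E) p).target) (hgK : ∀ x, x ∉ K → g x = 0) :
    IntegrableOn (fun a ↦ g (extChartAt 𝓘(ℝ, E) p a)) (extChartAt 𝓘(ℝ, E) p).source ν := by
  obtain ⟨hS, hSs⟩ := isCompact_symm_image hK hKt
  have hc : ContinuousOn (fun a ↦ g (extChartAt 𝓘(ℝ, E) p a)) (extChartAt 𝓘(ℝ, E) p).source :=
    hg.comp (continuousOn_extChartAt p) fun a ha ↦ (extChartAt 𝓘(ℝ, E) p).map_source ha
  refine ((hc.mono hSs).integrableOn_compact hS).of_forall_sdiff_eq_zero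
    (isOpen_extChartAt_source p).measurableSet fun a ha ↦ hgK _ fun h ↦ ha.2 ?_
  exact ⟨_, h, (extChartAt 𝓘(ℝ, E) p).left_inv ha.1⟩

/-- If a measure is invariant under transformations `Θ t` depending smoothly on `t`, with velocity
field `X` at `t = 0`, then the integral of the derivative along `X` of any compactly
supported function vanishes. The support is required to lie in a chart. -/
theorem integral_fderiv_eq_zero_of_invariant [LocallyCompactSpace M] {ν : Measure M}
    [IsFiniteMeasureOnCompacts ν] (p : M)
    {Θ Θ' : ℝ → M → M} {X : E → E}
    (hΘ : ∀ a, ContinuousAt (fun z : ℝ × M ↦ Θ z.1 z.2) (0, a))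
    (hΘ' : ∀ a, ContinuousAt (fun z : ℝ × M ↦ Θ' z.1 z.2) (0, a))
    (hΘ0 : ∀ a, Θ 0 a = a) (hinv : ∀ t a, Θ' t (Θ t a) = a)
    (hsmooth : ∀ x ∈ (extChartAt 𝓘(ℝ, E) p).target, ContDiffAt ℝ 1 (fun z : ℝ × E ↦
      extChartAt 𝓘(ℝ, E) p (Θ z.1 ((extChartAt 𝓘(ℝ, E) p).symm z.2))) (0, x))
    (hX : ∀ x ∈ (extChartAt 𝓘(ℝ, E) p).target, HasDerivAt (fun t ↦
      extChartAt 𝓘(ℝ, E) p (Θ t ((extChartAt 𝓘(ℝ, E) p).symm x))) (X x) 0)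
    (hint : ∀ (F : M → ℝ) (t : ℝ), ∫ a, F (Θ t a) ∂ν = ∫ a, F a ∂ν)
    {f : E → ℝ} (hf : ContDiff ℝ 1 f) (hfc : HasCompactSupport f)
    (hft : tsupport f ⊆ (extChartAt 𝓘(ℝ, E) p).target) :
    ∫ a in (extChartAt 𝓘(ℝ, E) p).source,
      fderiv ℝ f (extChartAt 𝓘(ℝ, E) p a) (X (extChartAt 𝓘(ℝ, E) p a)) ∂ν = 0 := by
  set φ := extChartAt 𝓘(ℝ, E) p with hφ
  have hso : IsOpen φ.source := isOpen_extChartAt_source p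
  obtain ⟨hS, hSs⟩ := isCompact_symm_image (M := M) (p := p) hfc hft
  set S := φ.symm '' tsupport f with hSdef
  obtain ⟨K, hK, hSK, hKs⟩ := exists_compact_between hS hso hSs
  have hΘ'0 (a : M) : Θ' 0 a = a := by simpa [hΘ0] using hinv 0 a
  set θ : ℝ × E → E := fun z ↦ φ (Θ z.1 (φ.symm z.2)) with hθ
  have hφK : ContinuousOn (fun z : ℝ × M ↦ (z.1, φ z.2)) (univ ×ˢ K) :=
    continuousOn_fst.prodMk (((continuousOn_extChartAt p).mono hKs).comp continuousOn_snd
      fun z hz ↦ hz.2)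
  -- for small `t`, the functions `F ∘ Θ t` below are supported in a fixed compact set `K`
  have e1 : ∀ᶠ t in 𝓝 (0 : ℝ), ∀ a ∈ S, Θ' t a ∈ K := by
    refine hS.eventually_forall_of_forall_eventually fun a ha ↦ ?_
    refine (hΘ' a).eventually (mem_interior_iff_mem_nhds.1 (hSK ?_))
    change Θ' 0 a ∈ S
    rwa [hΘ'0]
  have e2 : ∀ᶠ t in 𝓝 (0 : ℝ), ∀ a ∈ K, Θ t a ∈ φ.source := by
    refine hK.eventually_forall_of_forall_eventually fun a ha ↦ ?_
    refine (hΘ a).eventually (hso.mem_nhds ?_)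
    change Θ 0 a ∈ φ.source
    rw [hΘ0]
    exact hKs ha
  have e3 : ∀ᶠ t in 𝓝 (0 : ℝ), ∀ a ∈ K, ContDiffAt ℝ 1 θ (t, φ a) := by
    refine hK.eventually_forall_of_forall_eventually fun a ha ↦ ?_
    have hc : ContinuousAt (fun z : ℝ × M ↦ (z.1, φ z.2)) (0, a) :=
      continuousAt_fst.prodMk (ContinuousAt.comp (f := Prod.snd) (x := ((0 : ℝ), a))
        (continuousAt_extChartAt' (hKs ha)) continuousAt_snd)
    exact hc.eventually ((hsmooth _ (φ.map_source (hKs ha))).eventually (by simp))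
  obtain ⟨ε, hε, hball⟩ := Metric.eventually_nhds_iff_ball.1 ((e1.and e2).and e3)
  set J := Metric.closedBall (0 : ℝ) (ε / 2) with hJ
  have hJb : J ⊆ Metric.ball 0 ε := Metric.closedBall_subset_ball (by linarith)
  have hθ1 (t : ℝ) (ht : t ∈ J) (a : M) (ha : a ∈ K) : ContDiffAt ℝ 1 (f ∘ θ) (t, φ a) :=
    hf.contDiffAt.comp _ ((hball t (hJb ht)).2 a ha)
  set D : ℝ → M → ℝ := fun t a ↦ fderiv ℝ (f ∘ θ) (t, φ a) (1, 0) with hD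
  have hDc : ContinuousOn (fun z : ℝ × M ↦ D z.1 z.2) (J ×ˢ K) := by
    intro z hz
    have h1 : ContinuousAt (fun y ↦ fderiv ℝ (f ∘ θ) y (1, 0)) (z.1, φ z.2) :=
      (((hθ1 z.1 hz.1 z.2 hz.2).fderiv_right (m := 0) (by simp)).continuousAt).clm_apply
        continuousAt_const
    exact ContinuousAt.comp_continuousWithinAt (g := fun y ↦ fderiv ℝ (f ∘ θ) y (1, 0)) h1
      ((hφK.mono (prod_mono (subset_univ J) subset_rfl)) z hz)
  obtain ⟨C, hC⟩ :=
    ((isCompact_closedBall (0 : ℝ) (ε / 2)).prod hK).exists_bound_of_continuousOn hDc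
  set F : M → ℝ := φ.source.indicator fun a ↦ f (φ a) with hF
  have hFK (t : ℝ) (ht : t ∈ J) (a : M) (ha : a ∈ K) : F (Θ t a) = f (θ (t, φ a)) := by
    rw [hF, indicator_of_mem ((hball t (hJb ht)).1.2 a ha)]
    simp only [hθ, φ.left_inv (hKs ha)]
  have hFK' (t : ℝ) (ht : t ∈ J) (a : M) (ha : a ∉ K) : F (Θ t a) = 0 := by
    by_contra h
    have hs : Θ t a ∈ φ.source := mem_of_indicator_ne_zero h
    rw [hF, indicator_of_mem hs] at h
    refine ha ?_
    rw [← hinv t a]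
    exact (hball t (hJb ht)).1.1 _ ⟨_, subset_tsupport f h, φ.left_inv hs⟩
  have h0J : (0 : ℝ) ∈ J := Metric.mem_closedBall_self (by linarith)
  have hKm : MeasurableSet K := hK.measurableSet
  have hFi (t : ℝ) (ht : t ∈ J) : (fun a ↦ F (Θ t a)) = K.indicator fun a ↦ f (θ (t, φ a)) := by
    ext a
    by_cases ha : a ∈ K
    · rw [indicator_of_mem ha, hFK t ht a ha]
    · rw [indicator_of_notMem ha, hFK' t ht a ha]
  have hslice (t : ℝ) (ht : t ∈ J) {g : ℝ × M → ℝ} (hg : ContinuousOn g (J ×ˢ K)) :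
      ContinuousOn (fun a ↦ g (t, a)) K :=
    hg.comp (continuousOn_const.prodMk continuousOn_id) fun a ha ↦ ⟨ht, ha⟩
  have hθc : ContinuousOn (fun z : ℝ × M ↦ f (θ (z.1, φ z.2))) (J ×ˢ K) := by
    intro z hz
    exact ContinuousAt.comp_continuousWithinAt (g := f ∘ θ) (hθ1 z.1 hz.1 z.2 hz.2).continuousAt
      ((hφK.mono (prod_mono (subset_univ J) subset_rfl)) z hz)
  have hFint (t : ℝ) (ht : t ∈ J) : Integrable (fun a ↦ F (Θ t a)) ν := by
    rw [hFi t ht, integrable_indicator_iff hKm]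
    exact (hslice t ht hθc).integrableOn_compact hK
  have key := hasDerivAt_integral_of_dominated_loc_of_deriv_le (μ := ν) (𝕜 := ℝ)
    (s := Metric.ball 0 (ε / 2))
    (x₀ := (0 : ℝ)) (F := fun t a ↦ F (Θ t a)) (F' := fun t ↦ K.indicator (D t))
    (bound := K.indicator fun _ ↦ C) (Metric.ball_mem_nhds 0 (by linarith))
    (by
      filter_upwards [Metric.closedBall_mem_nhds (0 : ℝ) (half_pos hε)] with t ht
      exact (hFint t ht).aestronglyMeasurable)
    (hFint 0 h0J)
    (by
      refine Integrable.aestronglyMeasurable ?_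
      rw [integrable_indicator_iff hKm]
      exact (hslice 0 h0J hDc).integrableOn_compact hK)
    (by
      refine Eventually.of_forall fun a t ht ↦ ?_
      by_cases ha : a ∈ K
      · rw [indicator_of_mem ha, indicator_of_mem ha]
        exact hC (t, a) ⟨Metric.ball_subset_closedBall ht, ha⟩
      · rw [indicator_of_notMem ha, indicator_of_notMem ha, norm_zero])
    (by
      rw [integrable_indicator_iff hKm]
      exact integrableOn_const hK.measure_lt_top.ne)
    (by
      refine Eventually.of_forall fun a t ht ↦ ?_
      have hnhds : ∀ᶠ s in 𝓝 t, s ∈ J := by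
        filter_upwards [Metric.isOpen_ball.mem_nhds ht] with s hs
        exact Metric.ball_subset_closedBall hs
      by_cases ha : a ∈ K
      · rw [indicator_of_mem ha]
        have h1 := ((hθ1 t (Metric.ball_subset_closedBall ht) a ha).differentiableAt
          (by simp)).hasFDerivAt
        have h2 := HasFDerivAt.comp_hasDerivAt (f := fun s ↦ (s, φ a)) t h1
          ((hasDerivAt_id t).prodMk (hasDerivAt_const t (φ a)))
        refine h2.congr_of_eventuallyEq ?_
        filter_upwards [hnhds] with s hs
        exact hFK s hs a ha
      · rw [indicator_of_notMem ha]
        refine (hasDerivAt_const t (0 : ℝ)).congr_of_eventuallyEq ?_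
        filter_upwards [hnhds] with s hs
        exact hFK' s hs a ha)
  have hconst : (fun t ↦ ∫ a, F (Θ t a) ∂ν) = fun _ ↦ ∫ a, F a ∂ν := by
    ext t
    exact hint F t
  have hz : ∫ a, K.indicator (D 0) a ∂ν = 0 := by
    refine HasDerivAt.unique (f := fun t ↦ ∫ a, F (Θ t a) ∂ν) (x := 0) key.2 ?_
    rw [hconst]
    exact hasDerivAt_const 0 _
  rw [integral_indicator hKm] at hz
  rw [← hz, setIntegral_eq_of_subset_of_forall_sdiff_eq_zero hso.measurableSet hKs]
  · refine setIntegral_congr_fun hKm fun a ha ↦ ?_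
    have hx := φ.map_source (hKs ha)
    have h1 : HasFDerivAt (f ∘ θ) (fderiv ℝ (f ∘ θ) (0, φ a)) (0, φ a) :=
      ((hθ1 0 h0J a ha).differentiableAt (by simp)).hasFDerivAt
    have h2 := HasFDerivAt.comp_hasDerivAt (f := fun s : ℝ ↦ (s, φ a)) 0 h1
      ((hasDerivAt_id 0).prodMk (hasDerivAt_const 0 (φ a)))
    have h3 : HasFDerivAt f (fderiv ℝ f (φ a)) (φ (Θ 0 (φ.symm (φ a)))) := by
      rw [hΘ0, φ.left_inv (hKs ha)]
      exact (hf.differentiable (by simp)).differentiableAt.hasFDerivAt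
    exact (h3.comp_hasDerivAt 0 (hX _ hx)).unique h2
  · intro a ha
    have hφa : φ a ∉ tsupport f := fun h ↦
      ha.2 (interior_subset (hSK ⟨_, h, φ.left_inv ha.1⟩))
    rw [fderiv_of_notMem_tsupport (𝕜 := ℝ) hφa]
    rfl

end Divergence

/-! ### Bi-invariant Haar measures -/

section Haar

open Filter Set
open scoped Topology

variable {E : Type*} [NormedAddCommGroup E] [NormedSpace ℝ E]
  {G : Type*} [TopologicalSpace G] [ChartedSpace E G] [Group G]

local notation "φ" => extChartAt 𝓘(ℝ, E)

theorem continuousAt_symm_line (v : E) :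
    ContinuousAt (fun t : ℝ ↦ (φ (1 : G)).symm (φ (1 : G) 1 + t • v)) 0 := by
  refine ContinuousAt.comp (g := (φ (1 : G)).symm) ?_ (by fun_prop)
  rw [zero_smul, add_zero]
  exact continuousAt_extChartAt_symm (1 : G)

theorem symm_line_zero (v : E) : (φ (1 : G)).symm (φ (1 : G) 1 + (0 : ℝ) • v) = 1 := by
  rw [zero_smul, add_zero, extChartAt_to_inv]

theorem hasDerivAt_line (x v : E) : HasDerivAt (fun t : ℝ ↦ x + t • v) v 0 := by
  simpa using ((hasDerivAt_id (0 : ℝ)).smul_const v).const_add x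

variable [LieGroup 𝓘(ℝ, E) ∞ G]

/-- The coefficients, in the left-invariant frame, of the right-invariant field extending `v`. -/
theorem contDiffAt_inverse_leftFrame_rightFrame [FiniteDimensional ℝ E]
    {x : E} (hx : x ∈ (φ (1 : G)).target) (v : E) :
    ContDiffAt ℝ ∞ (fun y ↦ Ring.inverse (leftFrame (1 : G) y) (rightFrame G y v)) x := by
  have : CompleteSpace E := FiniteDimensional.complete ℝ E
  obtain ⟨u, hu⟩ := leftFrame_isUnit hx
  have h1 : ContDiffAt ℝ ∞ (Ring.inverse : (E →L[ℝ] E) → E →L[ℝ] E) (leftFrame (1 : G) x) := by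
    rw [← hu]
    exact contDiffAt_ringInverse ℝ u
  exact (h1.comp x (leftFrame_contDiffAt hx)).clm_apply
    ((rightFrame_contDiffAt hx).clm_apply contDiffAt_const)

variable [T2Space G] [MeasurableSpace G] [BorelSpace G] {ν : Measure G}
  [IsFiniteMeasureOnCompacts ν]

/-- The flows of right-invariant fields are left translations. -/
theorem integral_fderiv_rightFrame [LocallyCompactSpace G] [ν.IsMulLeftInvariant] (v : E)
    {f : E → ℝ} (hf : ContDiff ℝ 1 f) (hfc : HasCompactSupport f)
    (hft : tsupport f ⊆ (φ (1 : G)).target) :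
    ∫ a in (φ (1 : G)).source, fderiv ℝ f (φ (1 : G) a) (rightFrame G (φ (1 : G) a) v) ∂ν = 0 := by
  have hT : IsTopologicalGroup G := topologicalGroup_of_lieGroup 𝓘(ℝ, E) ∞
  set γ : ℝ → G := fun t ↦ (φ (1 : G)).symm (φ (1 : G) 1 + t • v) with hγ
  have hγc : ContinuousAt γ 0 := continuousAt_symm_line v
  have hγ0 : γ 0 = 1 := symm_line_zero v
  have hγc' (a : G) : ContinuousAt (fun z : ℝ × G ↦ γ z.1) (0, a) :=
    ContinuousAt.comp (f := Prod.fst) (x := ((0 : ℝ), a)) hγc continuousAt_fst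
  have hp := mem_extChartAt_target (I := 𝓘(ℝ, E)) (1 : G)
  refine integral_fderiv_eq_zero_of_invariant (1 : G) (Θ := fun t a ↦ γ t * a)
    (Θ' := fun t a ↦ (γ t)⁻¹ * a) (X := fun x ↦ rightFrame G x v) (fun a ↦ ?_) (fun a ↦ ?_)
    (fun a ↦ ?_) (fun t a ↦ ?_) (fun x hx ↦ ?_) (fun x hx ↦ ?_) (fun F t ↦ ?_) hf hfc hft
  · exact (hγc' a).mul continuousAt_snd
  · exact (hγc' a).inv.mul continuousAt_snd
  · simp [hγ0]
  · simp
  · have h1 : ContDiffAt ℝ 1 (chartMul (1 : G)) (φ (1 : G) 1 + (0 : ℝ) • v, x) := by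
      rw [zero_smul, add_zero]
      refine (chartMul_contDiffAt hp hx ?_).of_le (by simp)
      rw [extChartAt_to_inv, one_mul]
      exact (φ (1 : G)).map_target hx
    exact ContDiffAt.comp (f := fun z : ℝ × E ↦ (φ (1 : G) 1 + z.1 • v, z.2)) (0, x) h1
      (by fun_prop)
  · have h1 : HasFDerivAt (fun y ↦ chartMul (1 : G) (y, x)) (rightFrame G x)
        (φ (1 : G) 1 + (0 : ℝ) • v) := by
      rw [zero_smul, add_zero]
      exact rightFrame_hasFDerivAt hx
    exact HasFDerivAt.comp_hasDerivAt (f := fun t : ℝ ↦ φ (1 : G) 1 + t • v) 0 h1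
      (hasDerivAt_line _ v)
  · exact integral_mul_left_eq_self F (γ t)

/-- The flows of left-invariant fields are right translations. -/
theorem integral_fderiv_leftFrame [LocallyCompactSpace G] [ν.IsMulRightInvariant] (v : E)
    {f : E → ℝ} (hf : ContDiff ℝ 1 f) (hfc : HasCompactSupport f)
    (hft : tsupport f ⊆ (φ (1 : G)).target) :
    ∫ a in (φ (1 : G)).source,
      fderiv ℝ f (φ (1 : G) a) (leftFrame (1 : G) (φ (1 : G) a) v) ∂ν = 0 := by
  have hT : IsTopologicalGroup G := topologicalGroup_of_lieGroup 𝓘(ℝ, E) ∞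
  set γ : ℝ → G := fun t ↦ (φ (1 : G)).symm (φ (1 : G) 1 + t • v) with hγ
  have hγc : ContinuousAt γ 0 := continuousAt_symm_line v
  have hγ0 : γ 0 = 1 := symm_line_zero v
  have hγc' (a : G) : ContinuousAt (fun z : ℝ × G ↦ γ z.1) (0, a) :=
    ContinuousAt.comp (f := Prod.fst) (x := ((0 : ℝ), a)) hγc continuousAt_fst
  refine integral_fderiv_eq_zero_of_invariant (1 : G) (Θ := fun t a ↦ a * γ t)
    (Θ' := fun t a ↦ a * (γ t)⁻¹) (X := fun x ↦ leftFrame (1 : G) x v) (fun a ↦ ?_) (fun a ↦ ?_)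
    (fun a ↦ ?_) (fun t a ↦ ?_) (fun x hx ↦ ?_) (fun x hx ↦ ?_) (fun F t ↦ ?_) hf hfc hft
  · exact continuousAt_snd.mul (hγc' a)
  · exact continuousAt_snd.mul (hγc' a).inv
  · simp [hγ0]
  · simp
  · have h1 : ContDiffAt ℝ 1 (chartMul (1 : G)) (x, φ (1 : G) 1 + (0 : ℝ) • v) := by
      rw [zero_smul, add_zero]
      exact (chartMul_contDiffAt_base hx).of_le (by simp)
    exact ContDiffAt.comp (f := fun z : ℝ × E ↦ (z.2, φ (1 : G) 1 + z.1 • v)) (0, x) h1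
      (by fun_prop)
  · have h1 : HasFDerivAt (fun y ↦ chartMul (1 : G) (x, y)) (leftFrame (1 : G) x)
        (φ (1 : G) 1 + (0 : ℝ) • v) := by
      rw [zero_smul, add_zero]
      exact leftFrame_hasFDerivAt hx
    exact HasFDerivAt.comp_hasDerivAt (f := fun t : ℝ ↦ φ (1 : G) 1 + t • v) 0 h1
      (hasDerivAt_line _ v)
  · exact integral_mul_right_eq_self F (γ t)

/-- The trace of `ad v` is the divergence at the identity of the right-invariant field extending
`v`, for any right Haar measure. It vanishes if this measure is also left-invariant. -/
theorem trace_modelAd_eq_zero [FiniteDimensional ℝ E] [LocallyCompactSpace G] [ν.IsMulLeftInvariant]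
    [ν.IsMulRightInvariant] [ν.IsOpenPosMeasure] (v : E) :
    LinearMap.trace ℝ E (modelAd E G v) = 0 := by
  have : CompleteSpace E := FiniteDimensional.complete ℝ E
  set T := (φ (1 : G)).target with hTdef
  set x₀ : E := φ (1 : G) 1 with hx₀
  have hp : x₀ ∈ T := mem_extChartAt_target (I := 𝓘(ℝ, E)) (1 : G)
  have hTo : IsOpen T := isOpen_extChartAt_target 1
  set b := Module.finBasis ℝ E with hb
  set A : E → E := fun y ↦ Ring.inverse (leftFrame (1 : G) y) (rightFrame G y v) with hA
  have hAs (x : E) (hx : x ∈ T) : ContDiffAt ℝ ∞ A x :=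
    contDiffAt_inverse_leftFrame_rightFrame hx v
  let coord (j) : E →L[ℝ] ℝ := LinearMap.toContinuousLinearMap (b.coord j)
  -- the divergence of the right-invariant field, with respect to a right-invariant measure
  set s : E → ℝ := fun x ↦ ∑ j, coord j (fderiv ℝ A x (leftFrame (1 : G) x (b j))) with hs
  have hsc : ContinuousOn s T := by
    intro x hx
    refine ContinuousAt.continuousWithinAt ?_
    refine tendsto_finsetSum _ fun j _ ↦ ?_
    have h1 : ContinuousAt (fderiv ℝ A) x := ((hAs x hx).fderiv_right (m := 0)
      (by simp)).continuousAt
    exact (coord j).continuous.continuousAt.comp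
      (h1.clm_apply ((leftFrame_contDiffAt hx).continuousAt.clm_apply continuousAt_const))
  have hs0 : s x₀ = LinearMap.trace ℝ E (modelAd E G v) := by
    have hL := ((leftFrame_contDiffAt hp).differentiableAt (by simp)).hasFDerivAt
    have hR := ((rightFrame_contDiffAt hp).differentiableAt (by simp)).hasFDerivAt
    have h1 := (hasFDerivAt_ringInverse_mul hL hR leftFrame_one rightFrame_one).clm_apply
      (hasFDerivAt_const v x₀)
    have h2 (u : E) : fderiv ℝ A x₀ u = modelAd E G v u := by
      have h3 : HasFDerivAt A _ x₀ := h1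
      rw [h3.fderiv]
      simp only [ContinuousLinearMap.comp_zero, zero_add, ContinuousLinearMap.flip_apply,
        sub_apply, hx₀, fderiv_rightFrame_apply]
      rfl
    rw [LinearMap.trace_eq_matrix_trace ℝ b]
    simp only [hs, Matrix.trace, Matrix.diag_apply, LinearMap.toMatrix_apply]
    refine Finset.sum_congr rfl fun j _ ↦ ?_
    rw [h2, hx₀, leftFrame_one]
    rfl
  -- apply the invariance under right translations to the products of `f` with the coefficients of
  -- the right-invariant field in the left-invariant frame
  have key (f : E → ℝ) (hf : ContDiff ℝ ∞ f) (hfc : HasCompactSupport f) (hft : tsupport f ⊆ T) :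
      ∫ a in (φ (1 : G)).source, f (φ (1 : G) a) * s (φ (1 : G) a) ∂ν = 0 := by
    have hf1 : ContDiff ℝ 1 f := hf.of_le (by simp)
    have hfs (x : E) (hx : x ∉ tsupport f) : f =ᶠ[𝓝 x] 0 := notMem_tsupport_iff_eventuallyEq.1 hx
    set g : Fin (Module.finrank ℝ E) → E → ℝ := fun j y ↦ f y * coord j (A y) with hg
    have hga (j) (x : E) (hx : x ∈ T) : ContDiffAt ℝ ∞ (g j) x :=
      hf.contDiffAt.mul ((coord j).contDiff.contDiffAt.comp x (hAs x hx))
    have hgs (j) : ContDiff ℝ 1 (g j) := by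
      refine contDiff_iff_contDiffAt.2 fun x ↦ ?_
      by_cases hx : x ∈ T
      · exact (hga j x hx).of_le (by simp)
      · refine (contDiffAt_const (c := (0 : ℝ))).congr_of_eventuallyEq ?_
        filter_upwards [hfs x fun h ↦ hx (hft h)] with y hy
        simp [hg, hy]
    have hgt (j) : tsupport (g j) ⊆ tsupport f :=
      closure_mono fun x hx h ↦ hx (by simp [hg, h])
    have hgc (j) : HasCompactSupport (g j) := hfc.mul_right
    have hLc (w : E) : ContinuousOn (fun x ↦ leftFrame (1 : G) x w) T := fun x hx ↦
      ((leftFrame_contDiffAt hx).continuousAt.clm_apply continuousAt_const).continuousWithinAt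
    have hRc (w : E) : ContinuousOn (fun x ↦ rightFrame G x w) T := fun x hx ↦
      ((rightFrame_contDiffAt hx).continuousAt.clm_apply continuousAt_const).continuousWithinAt
    have hgi (j) := integrableOn_source_of_compact_support (ν := ν) (p := (1 : G))
      (g := fun x ↦ fderiv ℝ (g j) x (leftFrame (1 : G) x (b j))) hfc hft
      (((hgs j).continuous_fderiv (by simp)).continuousOn.clm_apply (hLc (b j)))
      (fun x hx ↦ by
        rw [fderiv_of_notMem_tsupport (𝕜 := ℝ) fun h ↦ hx (hgt j h)]
        rfl)
    have hfi := integrableOn_source_of_compact_support (ν := ν) (p := (1 : G))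
      (g := fun x ↦ fderiv ℝ f x (rightFrame G x v)) hfc hft
      ((hf1.continuous_fderiv (by simp)).continuousOn.clm_apply (hRc v))
      (fun x hx ↦ by
        rw [fderiv_of_notMem_tsupport (𝕜 := ℝ) hx]
        rfl)
    have hsplit (x : E) (hx : x ∈ T) : f x * s x =
        ∑ j, fderiv ℝ (g j) x (leftFrame (1 : G) x (b j)) - fderiv ℝ f x (rightFrame G x v) := by
      have hfd := (hf1.differentiable (by simp)).differentiableAt.hasFDerivAt (x := x)
      have hAd := ((hAs x hx).differentiableAt (by simp)).hasFDerivAt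
      have hgd (j) (u : E) : fderiv ℝ (g j) x u =
          f x * coord j (fderiv ℝ A x u) + coord j (A x) * fderiv ℝ f x u := by
        have h := hfd.mul ((coord j).hasFDerivAt.comp x hAd)
        have h' : HasFDerivAt (g j) _ x := h
        rw [h'.fderiv]
        simp
      have hR : rightFrame G x v = ∑ j, coord j (A x) • leftFrame (1 : G) x (b j) := by
        have h1 : leftFrame (1 : G) x (A x) = rightFrame G x v :=
          congrArg (fun B : E →L[ℝ] E ↦ B (rightFrame G x v))
            (Ring.mul_inverse_cancel _ (leftFrame_isUnit hx))
        rw [← h1]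
        conv_lhs => rw [← b.sum_repr (A x)]
        rw [map_sum]
        exact Finset.sum_congr rfl fun j _ ↦ map_smul _ _ _
      rw [hR, map_sum, ← Finset.sum_sub_distrib, hs, Finset.mul_sum]
      refine Finset.sum_congr rfl fun j _ ↦ ?_
      rw [hgd, map_smul, smul_eq_mul, add_sub_cancel_right]
    have hcongr := setIntegral_congr_fun (μ := ν)
      (isOpen_extChartAt_source (I := 𝓘(ℝ, E)) (1 : G)).measurableSet
      (fun a ha ↦ hsplit _ ((φ (1 : G)).map_source ha))
    rw [hcongr, integral_sub (integrable_finsetSum _ fun j _ ↦ hgi j) hfi,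
      integral_finsetSum _ fun j _ ↦ hgi j, integral_fderiv_rightFrame v hf1 hfc hft, sub_zero]
    exact Finset.sum_eq_zero fun j _ ↦
      integral_fderiv_leftFrame (b j) (hgs j) (hgc j) ((hgt j).trans hft)
  rw [← hs0]
  by_contra hne
  -- test the vanishing of the divergence against a bump function at the identity
  have hU : T ∩ s ⁻¹' {r | 0 < s x₀ * r} ∈ 𝓝 x₀ := by
    refine (hsc.isOpen_inter_preimage hTo ?_).mem_nhds ⟨hp, ?_⟩
    · exact isOpen_lt continuous_const (continuous_const.mul continuous_id)
    · exact mul_self_pos.2 hne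
  obtain ⟨ε, hε, hball⟩ := Metric.nhds_basis_closedBall.mem_iff.1 hU
  let f : ContDiffBump x₀ := ⟨ε / 2, ε, half_pos hε, half_lt_self hε⟩
  have hft : tsupport f ⊆ T := by
    rw [f.tsupport_eq]
    exact fun x hx ↦ (hball hx).1
  have hsrc := isOpen_extChartAt_source (I := 𝓘(ℝ, E)) (1 : G)
  have hzero := key f f.contDiff f.hasCompactSupport hft
  have hzero' : ∫ a in (φ (1 : G)).source,
      s x₀ * (f (φ (1 : G) a) * s (φ (1 : G) a)) ∂ν = 0 := by
    rw [integral_const_mul, hzero, mul_zero]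
  have hfi := integrableOn_source_of_compact_support (ν := ν) (p := (1 : G))
      (g := fun x ↦ s x₀ * (f x * s x)) f.hasCompactSupport hft
      (continuousOn_const.mul (f.continuous.continuousOn.mul hsc))
      (fun x hx ↦ by simp [image_eq_zero_of_notMem_tsupport hx])
  have hnonneg (x : E) : 0 ≤ s x₀ * (f x * s x) := by
    by_cases hx : x ∈ Metric.closedBall x₀ ε
    · have h : 0 ≤ s x₀ * s x := le_of_lt (hball hx).2
      have := mul_nonneg (f.nonneg (x := x)) h
      linarith
    · have hx' : x ∉ tsupport f := by rwa [f.tsupport_eq]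
      simp [image_eq_zero_of_notMem_tsupport hx']
  have hpos := (setIntegral_pos_iff_support_of_nonneg_ae
    (Eventually.of_forall fun a ↦ hnonneg (φ (1 : G) a)) hfi).2 ?_
  · exact hpos.ne' hzero'
  · refine lt_of_lt_of_le (IsOpen.measure_pos ν
      ((continuousOn_extChartAt (I := 𝓘(ℝ, E)) (1 : G)).isOpen_inter_preimage hsrc
        (Metric.isOpen_ball (x := x₀) (ε := ε)))
      ⟨1, mem_extChartAt_source 1, Metric.mem_ball_self (x := x₀) hε⟩) (measure_mono ?_)
    rintro a ⟨ha, hab⟩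
    refine ⟨?_, ha⟩
    have h1 : 0 < s x₀ * s (φ (1 : G) a) := (hball (Metric.ball_subset_closedBall hab)).2
    have h2 : 0 < f (φ (1 : G) a) := f.pos_of_mem_ball hab
    have h3 := mul_pos h2 h1
    have h4 : 0 < s x₀ * (f (φ (1 : G) a) * s (φ (1 : G) a)) := by
      rw [mul_left_comm]
      exact h3
    exact h4.ne'

end Haar

theorem IsInClassC.not_isUnimodular
    {E : Type*} [NormedAddCommGroup E] [NormedSpace ℝ E] [FiniteDimensional ℝ E]
    {G : Type*} [TopologicalSpace G] [T2Space G] [ChartedSpace E G] [Group G]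
    [LieGroup 𝓘(ℝ, E) ∞ G] [MeasurableSpace G] [BorelSpace G]
    (hG : IsInClassC E G) : ¬ IsUnimodular G := by
  intro hU
  have hT : IsTopologicalGroup G := topologicalGroup_of_lieGroup 𝓘(ℝ, E) ∞
  have hlc : LocallyCompactSpace G := Manifold.locallyCompact_of_finiteDimensional 𝓘(ℝ, E)
  obtain ⟨hrank, l, hl0, -, htr⟩ := hG.exists_form
  have hinv : (Measure.haar : Measure G).IsMulRightInvariant :=
    hU Measure.haar inferInstance inferInstance
  refine hl0 (LinearMap.ext fun v ↦ ?_)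
  have h := htr v
  rw [trace_modelAd_eq_zero (ν := (Measure.haar : Measure G)) v] at h
  have hn : (1 : ℝ) < Module.finrank ℝ E := by exact_mod_cast hrank
  exact (mul_eq_zero.1 h.symm).resolve_left (sub_pos.2 hn).ne'

end PseudoRiemannianLie

end

theorem mainTheorem5
    {E : Type*} [NormedAddCommGroup E] [NormedSpace ℝ E] [FiniteDimensional ℝ E]
    {G : Type*} [TopologicalSpace G] [T2Space G] [ChartedSpace E G] [Group G]
    [LieGroup 𝓘(ℝ, E) ∞ G] [MeasurableSpace G] [BorelSpace G]
    (hG : PseudoRiemannianLie.IsInClassC E G) :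
    ¬ PseudoRiemannianLie.IsUnimodular G ∧
      ∀ μ : PseudoRiemannianLie.PseudoRiemannianMetric E G,
        μ.IsLeftInvariant → μ.IsDegenerateOnDerivedIdeal →
          μ.IsFlatLeftInvariant ∧ ¬ μ.IsGeodesicallyComplete := by
  obtain ⟨-, l, hl0, hl, -⟩ := hG.exists_form
  refine ⟨hG.not_isUnimodular, fun μ hinv hdeg ↦ ?_⟩
  obtain ⟨d, hld, hd⟩ := hdeg.exists_dual_vector hl hl0
  exact ⟨μ.isFlatLeftInvariant_of_dual_vector hl hld hd,
    hinv.not_isGeodesicallyComplete hl hl0 hld hd⟩
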